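/- **Theorem 1 (Bernstein–von Mises theorem for the naive Bayes posterior).** Let $F_0$ be a probability measure on $(0,\infty)$ and, for $z\ge 0$, let $$g_0(z)=\int_{(z,\infty)}\frac{dF_0(s)}{2\sqrt{s^2-sz}} .$$ Assume that $\sup_{z\ge 0}g_0(z)<\infty$. Let $Z_1,Z_2,\dots$ be i.i.d. with law $G_0$, the law on $[0,\infty)$ with Lebesgue density $g_0$, and let $\mathbb G_n=\frac1n\sum_{i=1}^n\delta_{Z_i}$. Fix $x\ge 0$ and let $\alpha$ be a nonzero finite Borel measure on $[0,\infty)$ with $\int_{(x,\infty)}(s-x)^{-1/2}\,d\alpha(s)<\infty$. Give the law $G$ of the observations the Dirichlet process prior $\mathrm{DP}(\alpha)$, so that the posterior of $G$ is the Dirichlet process law $\mathrm{DP}(\alpha+n\mathbb G_n)$, and put $$V_G(x)=\int_{(x,\infty)}\frac{dG(z)}{\sqrt{z-x}},\qquad V_n(x)=\int_{(x,\infty)}\frac{d\mathbb G_n(z)}{\sqrt{z-x}} .$$ Then $V_G(x)$ is finite for posterior-almost every $G$, for every sample, and in probability under $G_0$ $$\frac{\sqrt n}{\sqrt{\log n}}\bigl(V_G(x)-V_n(x)\bigr)\;\Big|\;Z_1,\dots,Z_n\;\rightsquigarrow\;N\bigl(0,g_0(x)\bigr)\qquad(n\to\infty).$$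 That is, if $\mathcal L_n$ denotes the law of the left-hand side when $Z_1,\dots,Z_n$ are fixed and $G\sim\mathrm{DP}(\alpha+n\mathbb G_n)$, then $$\sup_{f}\Bigl|\int f\,d\mathcal L_n-\int f\,dN(0,g_0(x))\Bigr|\to 0\quad\text{in probability under } G_0,$$ where the supremum is over all bounded functions $f:\mathbb R\to\mathbb R$ with $|f(u)-f(v)|\le|u-v|$. (A law $\mathrm{DP}(\beta)$ is the law of a random probability measure $G$ such that $(G(A_1),\dots,G(A_k))$ is Dirichlet distributed with parameters $(\beta(A_1),\dots,\beta(A_k))$ for each finite measurable partition $A_1,\dots,A_k$; $N(0,0)$ is the point mass at $0$.) -/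

import Mathlib

open MeasureTheory ProbabilityTheory Filter Topology
open scoped ENNReal NNReal BoundedContinuousFunction

noncomputable section

namespace Wicksell

/-- The Gamma distribution with shape `a` and rate `1`, for `a ≥ 0`, with the usual convention
that the Gamma distribution with shape `0` is the point mass at `0`. -/
def gammaLaw (a : ℝ≥0) : Measure ℝ :=
  if a = 0 then Measure.dirac 0 else gammaMeasure (a : ℝ) 1

/-- The Dirichlet distribution with parameter vector `a` of nonnegative numbers (not all zero):
the law of `(Y₁ / S, …, Y_k / S)`, where the `Y_i` are independent, `Y_i ∼ Gamma(a_i, 1)` and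
`S = Y₁ + … + Y_k`. Coordinates with parameter `0` vanish. -/
def dirichletLaw {k : ℕ} (a : Fin k → ℝ≥0) : Measure (Fin k → ℝ) :=
  (Measure.pi fun i => gammaLaw (a i)).map fun y i => y i / ∑ j, y j

/-- `Q` is the law `DP(α)` of a Dirichlet process with base measure `α`: for a random probability
measure `G` with law `Q` and every finite measurable partition `A₁, …, A_k` of the sample space,
the vector `(G(A₁), …, G(A_k))` has the Dirichlet distribution with parameters
`(α(A₁), …, α(A_k))`. -/
structure IsDirichletProcess {X : Type*} [MeasurableSpace X] (α : Measure X)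
    (Q : Measure (ProbabilityMeasure X)) : Prop where
  isProbabilityMeasure : IsProbabilityMeasure Q
  map_partition : ∀ (k : ℕ) (A : Fin k → Set X), (∀ i, MeasurableSet (A i)) →
    Pairwise (fun i j => Disjoint (A i) (A j)) → (⋃ i, A i) = Set.univ →
    Q.map (fun G : ProbabilityMeasure X => fun i => (G : Measure X).real (A i)) =
      dirichletLaw fun i => (α (A i)).toNNReal

/-- The density `g₀(z) = ∫_{(z, ∞)} (2 √(s² - s z))⁻¹ dF₀(s)` of the observable squared radius,
when the unobservable squared radius has law `F₀`. -/
def obsDensity (F₀ : Measure ℝ) (z : ℝ) : ℝ≥0∞ :=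
  ∫⁻ s in Set.Ioi z, ENNReal.ofReal (1 / (2 * √(s ^ 2 - s * z))) ∂F₀

/-- The law `G₀` on `[0, ∞)` of the observations: it has Lebesgue density `g₀` there. -/
def obsLaw (F₀ : Measure ℝ) : Measure ℝ :=
  (volume.restrict (Set.Ici 0)).withDensity (obsDensity F₀)

/-- The functional `V_μ(x) = ∫_{(x, ∞)} (z - x)^{-1/2} dμ(z)`. -/
def inverseFunctional (μ : Measure ℝ) (x : ℝ) : ℝ :=
  ∫ z in Set.Ioi x, 1 / √(z - x) ∂μ

/-- The empirical measure `n⁻¹ ∑ δ_{z_i}`. -/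
def empiricalMeasure {n : ℕ} (z : Fin n → ℝ) : Measure ℝ :=
  (n : ℝ≥0∞)⁻¹ • ∑ i, Measure.dirac (z i)

/-- The base measure `α + n 𝔾_n = α + ∑ δ_{z_i}` of the Dirichlet process posterior. -/
def posteriorBase (α : Measure ℝ) {n : ℕ} (z : Fin n → ℝ) : Measure ℝ :=
  α + ∑ i, Measure.dirac (z i)

/-- The bounded Lipschitz distance: the supremum of `|∫ f dμ - ∫ f dν|` over the bounded functions
`f` with Lipschitz constant `1`. No common bound on the functions `f` is imposed, so this dominates
the distance with the additional restriction `‖f‖ ≤ 1`. -/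
def boundedLipschitzDist (μ ν : Measure ℝ) : ℝ≥0∞ :=
  ⨆ (f : ℝ →ᵇ ℝ) (_ : LipschitzWith 1 f), ENNReal.ofReal |∫ y, f y ∂μ - ∫ y, f y ∂ν|

/-- The law of `√n / √(log n) (V_G(x) - V_n(x))` given the sample `z`, when `G` has law `Q`. -/
def naivePosteriorLaw {n : ℕ} (Q : Measure (ProbabilityMeasure ℝ)) (z : Fin n → ℝ) (x : ℝ) :
    Measure ℝ :=
  Q.map fun G : ProbabilityMeasure ℝ => √(n : ℝ) / √(Real.log n) *
    (inverseFunctional (G : Measure ℝ) x - inverseFunctional (empiricalMeasure z) x)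

end Wicksell

end

/-!
The posterior `DP(α + ∑ δ_{zᵢ})` is a normalized Gamma process. For a function `h` with finitely
many values, `∫ h dG` is a linear functional of a Dirichlet vector, hence a ratio
`∑ⱼ yⱼ (Uⱼ + Wⱼ) / T` of Gamma variables, where `U` comes from the prior mass `α`, `W` from the
observations, and `T` is the sum of all of them. After centering at the empirical mean `v` and
multiplication by `n / r`, with `r = √(n log n)`, this is `(X₁ + X₂) n / T`, where
`X₁ = ∑ⱼ (yⱼ - v) Wⱼ / r` has the law of `∑ᵢ uᵢ (Eᵢ - 1)` for independent standard exponential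
variables `Eᵢ` and weights `uᵢ = (h(zᵢ) - v) / r`, and `X₂` is the contribution of the prior. Since
`n / T` is close to one in mean square and `E|X₂|` is of order `1 / r`, the law is close to the law
of `X₁` (`boundedLipschitzDist_dirichletLaw_le`). The unbounded integrand `(z - x)^{-1/2}` is
approximated in mean by functions `h` that keep its values at the observations; the error is
controlled because the mean of a Dirichlet process is its normalized base measure
(`IsDirichletProcess.lintegral_lintegral`), which also gives the finiteness of the functional
(`exists_boundedLipschitzDist_posterior_le`).

The law of `X₁` is asymptotically normal as soon as `∑ uᵢ² → g₀(x)` and `max |uᵢ| → 0`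
(`exists_boundedLipschitzDist_gaussian_le`). As no common bound is imposed on the test functions,
the distance is the Wasserstein distance of order one, and Lévy's continuity theorem is
supplemented by the bound on second moments (`tendsto_boundedLipschitzDist`).

The squared integrand `(Z - x)⁻¹` has a tail `H` with `t H(t) → g₀(x)`, because the law of the
observations has right derivative `g₀(x)` at `x` (`tendsto_mul_obsTail`). Its mean is infinite, but
truncation at `n log n` shows that its sum over the sample is `g₀(x) n log n` to first order while
no single term contributes (`tendsto_measure_sum_div_log`, `tendsto_measure_exists_lt`). This is
where the rate `√n / √(log n)` and the variance `g₀(x)` come from.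
-/

namespace Wicksell

/-! ### Gamma distributions -/

lemma gammaLaw_zero : gammaLaw 0 = Measure.dirac 0 := by simp [gammaLaw]

lemma gammaLaw_of_pos {a : ℝ≥0} (ha : 0 < a) : gammaLaw a = gammaMeasure a 1 := by
  simp [gammaLaw, ha.ne']

instance isProbabilityMeasure_gammaLaw (a : ℝ≥0) : IsProbabilityMeasure (gammaLaw a) := by
  rcases eq_or_ne a 0 with rfl | ha
  · rw [gammaLaw_zero]; infer_instance
  · have ha' : 0 < a := pos_iff_ne_zero.2 ha
    rw [gammaLaw_of_pos ha']
    exact isProbabilityMeasure_gammaMeasure (by exact_mod_cast ha') one_pos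

lemma lintegral_gammaLaw {a : ℝ≥0} (ha : 0 < a) {g : ℝ → ℝ≥0∞} (hg : Measurable g) :
    ∫⁻ y, g y ∂gammaLaw a = ∫⁻ y in Set.Ioi 0,
      ENNReal.ofReal (1 / Real.Gamma a * y ^ ((a : ℝ) - 1) * Real.exp (-y)) * g y := by
  have hm : Measurable (gammaPDF a 1) := by unfold gammaPDF; fun_prop
  rw [gammaLaw_of_pos ha, gammaMeasure, lintegral_withDensity_eq_lintegral_mul _ hm hg,
    ← lintegral_add_compl _ (measurableSet_Ici (a := (0 : ℝ)))]
  have h0 : ∫⁻ y in (Set.Ici (0 : ℝ))ᶜ, (gammaPDF a 1 * g) y = 0 := by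
    rw [setLIntegral_congr_fun (g := fun _ => 0) measurableSet_Ici.compl, lintegral_zero]
    intro y hy
    simp only [Set.mem_compl_iff, Set.mem_Ici, not_le] at hy
    simp [gammaPDF_of_neg hy]
  rw [h0, add_zero, setLIntegral_congr Ioi_ae_eq_Ici.symm]
  refine setLIntegral_congr_fun measurableSet_Ioi fun y hy => ?_
  simp only [Pi.mul_apply, gammaPDF_of_nonneg (le_of_lt hy), Real.one_rpow, one_mul]

lemma ae_gammaLaw_pos {a : ℝ≥0} (ha : 0 < a) : ∀ᵐ y ∂gammaLaw a, 0 < y := by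
  have h := lintegral_gammaLaw ha (g := (Set.Iic (0 : ℝ)).indicator 1)
    (measurable_one.indicator measurableSet_Iic)
  rw [lintegral_indicator_one measurableSet_Iic,
    setLIntegral_congr_fun (g := fun _ => 0) measurableSet_Ioi, lintegral_zero] at h
  · rw [ae_iff]
    simpa [not_lt, Set.Iic] using h
  · intro y hy
    simp [Set.indicator, not_le.2 (Set.mem_Ioi.1 hy)]

lemma ae_gammaLaw_nonneg (a : ℝ≥0) : ∀ᵐ y ∂gammaLaw a, 0 ≤ y := by
  rcases eq_or_ne a 0 with rfl | ha
  · rw [gammaLaw_zero, ae_dirac_iff measurableSet_Ici]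
  · filter_upwards [ae_gammaLaw_pos (pos_iff_ne_zero.2 ha)] with y hy using hy.le

/-- Size-biasing a Gamma law increases its shape by one. All the moments of Gamma laws that are
needed, of positive and of negative order, come from this identity. -/
lemma lintegral_gammaLaw_size_bias (a : ℝ≥0) {g : ℝ → ℝ≥0∞} (hg : Measurable g) :
    ∫⁻ y, ENNReal.ofReal y * g y ∂gammaLaw a = a * ∫⁻ y, g y ∂gammaLaw (a + 1) := by
  rcases eq_or_ne a 0 with rfl | ha
  · rw [gammaLaw_zero, lintegral_dirac' _ (by fun_prop)]; simp
  have ha' : 0 < a := pos_iff_ne_zero.2 ha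
  have haR : (0 : ℝ) < a := by exact_mod_cast ha'
  rw [lintegral_gammaLaw ha' (by fun_prop), lintegral_gammaLaw (by positivity) hg,
    ← lintegral_const_mul _ (by fun_prop)]
  refine setLIntegral_congr_fun measurableSet_Ioi fun y hy => ?_
  have hy : 0 < y := hy
  have hG := Real.Gamma_pos_of_pos haR
  rw [← mul_assoc, ← mul_assoc, ← ENNReal.ofReal_mul (by positivity),
    ← ENNReal.ofReal_coe_nnreal (p := a), ← ENNReal.ofReal_mul (by positivity)]
  congr 2
  rw [NNReal.coe_add, NNReal.coe_one, Real.Gamma_add_one haR.ne', add_sub_cancel_right]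
  have : y ^ (a : ℝ) = y ^ ((a : ℝ) - 1) * y := by
    rw [← Real.rpow_add_one hy.ne']; simp
  rw [this]
  field_simp

lemma lintegral_gammaLaw_id (a : ℝ≥0) : ∫⁻ y, ENNReal.ofReal y ∂gammaLaw a = a := by
  simpa using lintegral_gammaLaw_size_bias a (g := fun _ => 1) measurable_const

lemma lintegral_gammaLaw_sq (a : ℝ≥0) :
    ∫⁻ y, ENNReal.ofReal (y ^ 2) ∂gammaLaw a = a * (a + 1) := by
  have h := lintegral_gammaLaw_size_bias a (g := fun y => ENNReal.ofReal y) (by fun_prop)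
  rw [lintegral_gammaLaw_id] at h
  rw [← ENNReal.coe_one, ← ENNReal.coe_add, ← h]
  refine lintegral_congr_ae ?_
  filter_upwards [ae_gammaLaw_nonneg a] with y hy
  rw [← ENNReal.ofReal_mul hy, sq]

lemma lintegral_gammaLaw_inv {a : ℝ≥0} (ha : 0 < a) :
    ∫⁻ y, ENNReal.ofReal y⁻¹ ∂gammaLaw (a + 1) = (a : ℝ≥0∞)⁻¹ := by
  have h := lintegral_gammaLaw_size_bias a (g := fun y => ENNReal.ofReal y⁻¹) (by fun_prop)
  have h1 : ∫⁻ y, ENNReal.ofReal y * ENNReal.ofReal y⁻¹ ∂gammaLaw a = 1 := by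
    rw [← measure_univ (μ := gammaLaw a), ← lintegral_one]
    refine lintegral_congr_ae ?_
    filter_upwards [ae_gammaLaw_pos ha] with y hy
    rw [← ENNReal.ofReal_mul hy.le, mul_inv_cancel₀ hy.ne', ENNReal.ofReal_one]
  rw [h1] at h
  exact ENNReal.eq_inv_of_mul_eq_one_left (by rw [mul_comm]; exact h.symm)

lemma lintegral_gammaLaw_inv_sq {a : ℝ≥0} (ha : 0 < a) :
    ∫⁻ y, ENNReal.ofReal (y⁻¹ ^ 2) ∂gammaLaw (a + 2) = (a : ℝ≥0∞)⁻¹ * ((a : ℝ≥0∞) + 1)⁻¹ := by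
  have h := lintegral_gammaLaw_size_bias (a + 1) (g := fun y => ENNReal.ofReal (y⁻¹ ^ 2))
    (by fun_prop)
  have h1 : ∫⁻ y, ENNReal.ofReal y * ENNReal.ofReal (y⁻¹ ^ 2) ∂gammaLaw (a + 1) =
      (a : ℝ≥0∞)⁻¹ := by
    rw [← lintegral_gammaLaw_inv ha]
    refine lintegral_congr_ae ?_
    filter_upwards [ae_gammaLaw_pos (a := a + 1) (by positivity)] with y hy
    rw [← ENNReal.ofReal_mul hy.le]
    congr 1
    field_simp
  rw [h1, add_assoc, one_add_one_eq_two] at h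
  rw [h, mul_comm, ← mul_assoc, ENNReal.coe_add, ENNReal.coe_one, ENNReal.inv_mul_cancel, one_mul]
  · simp
  · simp

lemma mgf_gammaLaw {a : ℝ≥0} (ha : 0 < a) {t : ℝ} (ht : t < 1) :
    mgf id (gammaLaw a) t = (1 - t) ^ (-(a : ℝ)) := by
  have haR : (0 : ℝ) < a := by exact_mod_cast ha
  have hr : 0 < 1 - t := by linarith
  have hG := Real.Gamma_pos_of_pos haR
  rw [mgf, integral_eq_lintegral_of_nonneg_ae (ae_of_all _ fun y => (Real.exp_pos _).le)
    (by fun_prop), lintegral_gammaLaw ha (by fun_prop)]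
  have h := Real.integral_rpow_mul_exp_neg_mul_Ioi haR hr
  rw [setLIntegral_congr_fun (g := fun y => ENNReal.ofReal (1 / Real.Gamma a *
    (y ^ ((a : ℝ) - 1) * Real.exp (-((1 - t) * y))))) measurableSet_Ioi,
    ← integral_eq_lintegral_of_nonneg_ae, integral_const_mul, h]
  · rw [one_div (1 - t), Real.inv_rpow hr.le, Real.rpow_neg hr.le]
    field_simp
  · refine (ae_restrict_iff' measurableSet_Ioi).2 (ae_of_all _ fun y (hy : 0 < y) => ?_)
    dsimp only [Pi.zero_apply]
    positivity
  · exact Measurable.aestronglyMeasurable (by fun_prop)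
  · intro y hy
    have hy : 0 < y := hy
    dsimp only
    rw [← ENNReal.ofReal_mul (by positivity), mul_assoc, mul_assoc, ← Real.exp_add]
    simp only [id]
    congr 4
    ring

lemma Iio_one_subset_integrableExpSet_gammaLaw (a : ℝ≥0) (ha : 0 < a) :
    Set.Iio (1 : ℝ) ⊆ integrableExpSet id (gammaLaw a) := by
  intro t ht
  by_contra h
  have h1 := mgf_gammaLaw ha ht
  rw [mgf, integral_undef h] at h1
  have : (0 : ℝ) < (1 - t) ^ (-(a : ℝ)) := Real.rpow_pos_of_pos (sub_pos.2 ht) _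
  linarith

/-- The formula extends from the moment generating function on `(-∞, 1)` to the half plane
`re z < 1` by analytic continuation. -/
lemma charFun_gammaLaw (a : ℝ≥0) (t : ℝ) :
    charFun (gammaLaw a) t = (1 - t * Complex.I) ^ (-(a : ℂ)) := by
  rcases eq_or_ne a 0 with rfl | ha0
  · simp [gammaLaw_zero, charFun_dirac]
  have ha : 0 < a := pos_iff_ne_zero.2 ha0
  set U : Set ℂ := {z | z.re < 1} with hU
  have hUo : IsOpen U := isOpen_lt Complex.continuous_re continuous_const
  have hUc : IsPreconnected U := (convex_halfSpace_re_lt 1).isPreconnected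
  have hf : AnalyticOnNhd ℂ (complexMGF id (gammaLaw a)) U := by
    intro z hz
    refine analyticAt_complexMGF ?_
    exact interior_mono (Iio_one_subset_integrableExpSet_gammaLaw a ha)
      (by rw [interior_Iio]; exact hz)
  have hslit : ∀ z ∈ U, 1 - z ∈ Complex.slitPlane := fun z hz => by
    left
    have : z.re < 1 := hz
    simp only [Complex.sub_re, Complex.one_re]; linarith
  have hg : AnalyticOnNhd ℂ (fun z : ℂ => (1 - z) ^ (-(a : ℂ))) U := by
    refine DifferentiableOn.analyticOnNhd (fun z hz => ?_) hUo
    exact (DifferentiableAt.cpow (by fun_prop) (by fun_prop) (hslit z hz)).differentiableWithinAt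
  have heq := hf.eqOn_of_preconnected_of_frequently_eq hg hUc (z₀ := 0) (by simp [hU]) ?_
  · have h := heq (x := t * Complex.I) (by simp [hU])
    rw [complexMGF_id_mul_I] at h
    exact h
  · have hreal : ∀ s : ℝ, s < 1 → complexMGF id (gammaLaw a) s = (1 - (s : ℂ)) ^ (-(a : ℂ)) := by
      intro s hs
      rw [complexMGF_ofReal, mgf_gammaLaw ha hs, Complex.ofReal_cpow (by linarith)]
      simp
    have hseq : Tendsto (fun n : ℕ => (((1 / ((n : ℝ) + 2) : ℝ)) : ℂ)) atTop (𝓝[≠] 0) := by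
      refine tendsto_nhdsWithin_iff.2 ⟨?_, Eventually.of_forall fun n => ?_⟩
      · have h2 : Tendsto (fun n : ℕ => (1 / ((n : ℝ) + 2) : ℝ)) atTop (𝓝 0) := by
          have := tendsto_one_div_add_atTop_nhds_zero_nat (𝕜 := ℝ)
          refine ((tendsto_add_atTop_iff_nat 1).2 this).congr fun n => ?_
          push_cast; ring_nf
        exact (Complex.continuous_ofReal.tendsto' 0 0 Complex.ofReal_zero).comp h2
      · have : (1 / ((n : ℝ) + 2) : ℝ) ≠ 0 := by positivity
        exact Complex.ofReal_ne_zero.2 this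
    refine hseq.frequently (Eventually.of_forall fun n => ?_).frequently
    refine hreal _ ?_
    rw [div_lt_one (by positivity)]
    have : (0 : ℝ) ≤ n := n.cast_nonneg
    linarith

lemma one_sub_mul_I_ne_zero (t : ℝ) : (1 - t * Complex.I : ℂ) ≠ 0 := by
  intro h
  simpa using congrArg Complex.re h

lemma gammaLaw_conv (a b : ℝ≥0) : gammaLaw a ∗ gammaLaw b = gammaLaw (a + b) := by
  refine Measure.ext_of_charFun (funext fun t => ?_)
  rw [charFun_conv, charFun_gammaLaw, charFun_gammaLaw, charFun_gammaLaw,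
    ← Complex.cpow_add _ _ (one_sub_mul_I_ne_zero t)]
  congr 1
  push_cast
  ring

lemma charFun_gammaLaw_nat (n : ℕ) (t : ℝ) :
    charFun (gammaLaw n) t = ((1 - t * Complex.I) ^ n)⁻¹ := by
  rw [charFun_gammaLaw, Complex.cpow_neg]
  simp

lemma map_sum_pi_gammaLaw {k : ℕ} (a : Fin k → ℝ≥0) :
    (Measure.pi fun i => gammaLaw (a i)).map (fun y => ∑ i, y i) = gammaLaw (∑ i, a i) := by
  refine Measure.ext_of_charFun (funext fun t => ?_)
  rw [charFun_map_sum_pi_eq_prod, Finset.prod_apply]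
  simp_rw [charFun_gammaLaw]
  have : ∀ s : Finset (Fin k), ∏ i ∈ s, (1 - t * Complex.I : ℂ) ^ (-(a i : ℂ)) =
      (1 - t * Complex.I : ℂ) ^ (-((∑ i ∈ s, a i : ℝ≥0) : ℂ)) := by
    intro s
    induction s using Finset.induction_on with
    | empty => simp
    | insert i s hi ih =>
      rw [Finset.prod_insert hi, Finset.sum_insert hi, ih,
        ← Complex.cpow_add _ _ (one_sub_mul_I_ne_zero t)]
      congr 1
      push_cast
      ring
  exact this Finset.univ

/-! ### The bounded Lipschitz distance -/

lemma boundedLipschitzDist_triangle (μ ν ρ : Measure ℝ) :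
    boundedLipschitzDist μ ρ ≤ boundedLipschitzDist μ ν + boundedLipschitzDist ν ρ := by
  refine iSup₂_le fun f hf => ?_
  refine le_trans ?_ (add_le_add (le_iSup₂ (f := fun (f : ℝ →ᵇ ℝ) (_ : LipschitzWith 1 f) =>
    ENNReal.ofReal |∫ y, f y ∂μ - ∫ y, f y ∂ν|) f hf) (le_iSup₂ (f := fun (f : ℝ →ᵇ ℝ)
    (_ : LipschitzWith 1 f) => ENNReal.ofReal |∫ y, f y ∂ν - ∫ y, f y ∂ρ|) f hf))
  rw [← ENNReal.ofReal_add (abs_nonneg _) (abs_nonneg _)]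
  exact ENNReal.ofReal_le_ofReal (abs_sub_le _ _ _)

/-- Any coupling bounds the distance. -/
lemma boundedLipschitzDist_map_le {S : Type*} [MeasurableSpace S] (P : Measure S)
    [IsProbabilityMeasure P] {X Y : S → ℝ} (hX : AEMeasurable X P) (hY : AEMeasurable Y P) :
    boundedLipschitzDist (P.map X) (P.map Y) ≤ ∫⁻ s, ENNReal.ofReal |X s - Y s| ∂P := by
  refine iSup₂_le fun f hf => ?_
  have hint : ∀ {V : S → ℝ}, AEMeasurable V P → Integrable (fun s => f (V s)) P := fun hV =>
    Integrable.of_bound (f.continuous.measurable.comp_aemeasurable hV).aestronglyMeasurable ‖f‖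
      (ae_of_all _ fun s => f.norm_coe_le_norm _)
  rw [integral_map hX f.continuous.aestronglyMeasurable,
    integral_map hY f.continuous.aestronglyMeasurable, ← integral_sub (hint hX) (hint hY),
    ← Real.enorm_eq_ofReal_abs]
  refine (enorm_integral_le_lintegral_enorm _).trans (lintegral_mono fun s => ?_)
  rw [Real.enorm_eq_ofReal_abs]
  refine ENNReal.ofReal_le_ofReal ?_
  have := hf.dist_le_mul (X s) (Y s)
  simpa [Real.dist_eq] using this

/-- The ramp that vanishes to the left of `b`, has slope one on `[b, b + h]` and is constant to
the right of `b + h`. -/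
noncomputable def ramp (b h : ℝ) (hh : 0 ≤ h) : ℝ →ᵇ ℝ :=
  BoundedContinuousFunction.ofNormedAddCommGroup (fun x => min (max (x - b) 0) h) (by fun_prop) h
    fun x => by
      rw [Real.norm_eq_abs, abs_of_nonneg (le_min (le_max_right _ _) hh)]
      exact min_le_right _ _

lemma ramp_apply (b h : ℝ) (hh : 0 ≤ h) (x : ℝ) : ramp b h hh x = min (max (x - b) 0) h := rfl

lemma ramp_of_le {b h : ℝ} (hh : 0 ≤ h) {x : ℝ} (hx : x ≤ b) : ramp b h hh x = 0 := by
  rw [ramp_apply, max_eq_right (by linarith), min_eq_left hh]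

lemma ramp_of_ge {b h : ℝ} (hh : 0 ≤ h) {x : ℝ} (hx : b + h ≤ x) : ramp b h hh x = h := by
  rw [ramp_apply, max_eq_left (by linarith), min_eq_right (by linarith)]

lemma abs_ramp_le (b h : ℝ) (hh : 0 ≤ h) (x : ℝ) : |ramp b h hh x| ≤ h := by
  rw [ramp_apply, abs_of_nonneg (le_min (le_max_right _ _) hh)]
  exact min_le_right _ _

/-- The piecewise linear interpolation of `f` at the nodes `b, b + h, …, b + N h`. -/
noncomputable def interpolation (f : ℝ → ℝ) (b h : ℝ) (hh : 0 ≤ h) (N : ℕ) (x : ℝ) : ℝ :=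
  f b + ∑ j ∈ Finset.range N,
    (f (b + (j + 1) * h) - f (b + j * h)) / h * ramp (b + j * h) h hh x

lemma abs_sub_interpolation_le {f : ℝ → ℝ} (hf : LipschitzWith 1 f) (b : ℝ) {h : ℝ} (hh : 0 < h)
    (N : ℕ) : (∀ x, b + N * h ≤ x → interpolation f b h hh.le N x = f (b + N * h)) ∧
      ∀ x, b ≤ x → x ≤ b + N * h → |f x - interpolation f b h hh.le N x| ≤ 2 * h := by
  have hL : ∀ x y, |f x - f y| ≤ |x - y| := fun x y => by
    simpa [Real.dist_eq] using hf.dist_le_mul x y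
  induction N with
  | zero =>
    refine ⟨fun x hx => by simp [interpolation], fun x h1 h2 => ?_⟩
    have : x = b := le_antisymm (by simpa using h2) h1
    simp [interpolation, this, hh.le]
  | succ N ih =>
    have hs : ∀ x, interpolation f b h hh.le (N + 1) x = interpolation f b h hh.le N x +
        (f (b + (N + 1) * h) - f (b + N * h)) / h * ramp (b + N * h) h hh.le x := fun x => by
      simp only [interpolation, Finset.sum_range_succ]; ring
    push_cast
    refine ⟨fun x hx => ?_, fun x h1 h2 => ?_⟩
    · rw [hs, ih.1 x (by linarith), ramp_of_ge hh.le (by linarith)]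
      field_simp
      ring
    · rcases le_total x (b + N * h) with hx | hx
      · rw [hs, ramp_of_le hh.le hx, mul_zero, add_zero]
        exact ih.2 x h1 hx
      · rw [hs, ih.1 x hx]
        have e1 : |f x - f (b + N * h)| ≤ h := by
          refine (hL _ _).trans ?_
          rw [abs_of_nonneg (by linarith)]
          linarith
        have e2 : |(f (b + (N + 1) * h) - f (b + N * h)) / h * ramp (b + N * h) h hh.le x| ≤ h := by
          rw [abs_mul, abs_div, abs_of_pos hh]
          have e3 : |f (b + (N + 1) * h) - f (b + N * h)| / h ≤ 1 := by
            rw [div_le_one hh]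
            refine (hL _ _).trans ?_
            rw [show b + (N + 1) * h - (b + N * h) = h by ring, abs_of_pos hh]
          calc _ ≤ 1 * h := mul_le_mul e3 (abs_ramp_le _ _ _ _) (abs_nonneg _) zero_le_one
            _ = h := one_mul h
        have := abs_sub (f x - f (b + N * h))
          ((f (b + (N + 1) * h) - f (b + N * h)) / h * ramp (b + N * h) h hh.le x)
        rw [← sub_sub]
        linarith

lemma abs_sub_interpolation_le_add_sq {f : ℝ → ℝ} (hf : LipschitzWith 1 f) {M h : ℝ} (hM : 0 < M)
    (hh : 0 < h) {N : ℕ} (hN : N * h = 2 * M) (x : ℝ) :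
    |f x - interpolation f (-M) h hh.le N x| ≤ 2 * h + x ^ 2 / M := by
  have hL : ∀ x y, |f x - f y| ≤ |x - y| := fun x y => by
    simpa [Real.dist_eq] using hf.dist_le_mul x y
  obtain ⟨h1, h2⟩ := abs_sub_interpolation_le hf (-M) hh N
  have hq : 0 ≤ x ^ 2 / M := by positivity
  have key : ∀ y : ℝ, M ≤ |x| → y ≤ |x| → y ≤ x ^ 2 / M := fun y hy hy' => by
    rw [le_div_iff₀ hM, ← sq_abs]
    nlinarith [abs_nonneg x]
  have hend : -M + N * h = M := by linarith
  rcases le_total x (-M) with hx | hx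
  · have : interpolation f (-M) h hh.le N x = f (-M) := by
      rw [interpolation, Finset.sum_eq_zero, add_zero]
      intro j _
      rw [ramp_of_le hh.le, mul_zero]
      have : 0 ≤ (j : ℝ) * h := by positivity
      linarith
    rw [this]
    have h3 := key |x - -M| (by rw [abs_of_nonpos (by linarith)]; linarith)
      (by rw [abs_of_nonpos (by linarith : x ≤ 0), abs_of_nonpos (by linarith)]; linarith)
    linarith [hL x (-M)]
  · rcases le_total x M with hx' | hx'
    · linarith [h2 x hx (by rw [hend]; exact hx')]
    · rw [h1 x (by rw [hend]; exact hx'), hend]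
      have h3 := key |x - M| (by rw [abs_of_nonneg (by linarith)]; linarith)
        (by rw [abs_of_nonneg (by linarith : 0 ≤ x), abs_of_nonneg (by linarith)]; linarith)
      linarith [hL x M]

lemma integrable_sq_of_lintegral_le {μ : Measure ℝ} {C : ℝ}
    (h : ∫⁻ x, ENNReal.ofReal (x ^ 2) ∂μ ≤ ENNReal.ofReal C) : Integrable (fun x => x ^ 2) μ := by
  refine ⟨by fun_prop, ?_⟩
  rw [hasFiniteIntegral_iff_ofReal (ae_of_all _ fun x => sq_nonneg x)]
  exact h.trans_lt ENNReal.ofReal_lt_top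

lemma integral_sq_le_of_lintegral_le {μ : Measure ℝ} {C : ℝ} (hC : 0 ≤ C)
    (h : ∫⁻ x, ENNReal.ofReal (x ^ 2) ∂μ ≤ ENNReal.ofReal C) : ∫ x, x ^ 2 ∂μ ≤ C := by
  rw [integral_eq_lintegral_of_nonneg_ae (ae_of_all _ fun x => sq_nonneg x) (by fun_prop)]
  exact ENNReal.toReal_le_of_le_ofReal hC h

/-- Interpolation reduces all Lipschitz functions to finitely many test functions, up to an error
controlled by the second moments. -/
lemma abs_integral_sub_integral_le {μ ν : Measure ℝ} [IsProbabilityMeasure μ]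
    [IsProbabilityMeasure ν] {C : ℝ} (hC : 0 ≤ C)
    (hμ : ∫⁻ x, ENNReal.ofReal (x ^ 2) ∂μ ≤ ENNReal.ofReal C)
    (hν : ∫⁻ x, ENNReal.ofReal (x ^ 2) ∂ν ≤ ENNReal.ofReal C)
    {M h : ℝ} (hM : 0 < M) (hh : 0 < h) {N : ℕ} (hN : N * h = 2 * M)
    (f : ℝ →ᵇ ℝ) (hf : LipschitzWith 1 f) :
    |∫ x, f x ∂μ - ∫ x, f x ∂ν| ≤
      (∑ j ∈ Finset.range N, |∫ x, ramp (-M + j * h) h hh.le x ∂μ -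
        ∫ x, ramp (-M + j * h) h hh.le x ∂ν|) + 2 * (2 * h + C / M) := by
  set g := interpolation f (-M) h hh.le N with hg
  have hgi : ∀ (ρ : Measure ℝ) [IsProbabilityMeasure ρ], ∀ j : ℕ,
      Integrable (fun x => (f (-M + (j + 1) * h) - f (-M + j * h)) / h *
        ramp (-M + j * h) h hh.le x) ρ := fun ρ _ j =>
    ((ramp (-M + j * h) h hh.le).integrable ρ).const_mul _
  have hg_int : ∀ (ρ : Measure ℝ) [IsProbabilityMeasure ρ], Integrable g ρ := fun ρ _ =>
    (integrable_const _).add (integrable_finsetSum _ fun j _ => hgi ρ j)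
  have hg_eq : ∀ (ρ : Measure ℝ) [IsProbabilityMeasure ρ], ∫ x, g x ∂ρ = f (-M) +
      ∑ j ∈ Finset.range N, (f (-M + (j + 1) * h) - f (-M + j * h)) / h *
        ∫ x, ramp (-M + j * h) h hh.le x ∂ρ := fun ρ _ => by
    simp only [hg, interpolation]
    rw [integral_add (integrable_const _) (integrable_finsetSum _ fun j _ => hgi ρ j),
      integral_finsetSum _ fun j _ => hgi ρ j]
    simp only [integral_const_mul, integral_const, probReal_univ, one_smul]
  have herr : ∀ (ρ : Measure ℝ) [IsProbabilityMeasure ρ],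
      ∫⁻ x, ENNReal.ofReal (x ^ 2) ∂ρ ≤ ENNReal.ofReal C →
      |∫ x, f x ∂ρ - ∫ x, g x ∂ρ| ≤ 2 * h + C / M := fun ρ _ hρ => by
    rw [← integral_sub (f.integrable ρ) (hg_int ρ)]
    have hsq := integrable_sq_of_lintegral_le hρ
    calc |∫ x, (f x - g x) ∂ρ| ≤ ∫ x, |f x - g x| ∂ρ := abs_integral_le_integral_abs
      _ ≤ ∫ x, (2 * h + x ^ 2 / M) ∂ρ :=
          integral_mono ((f.integrable ρ).sub (hg_int ρ)).abs
            ((integrable_const _).add (hsq.div_const M))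
            fun x => abs_sub_interpolation_le_add_sq hf hM hh hN x
      _ = 2 * h + (∫ x, x ^ 2 ∂ρ) / M := by
          rw [integral_add (integrable_const _) (hsq.div_const M), integral_div]
          simp
      _ ≤ 2 * h + C / M := by
          gcongr
          exact integral_sq_le_of_lintegral_le hC hρ
  have hmid : |∫ x, g x ∂μ - ∫ x, g x ∂ν| ≤
      ∑ j ∈ Finset.range N, |∫ x, ramp (-M + j * h) h hh.le x ∂μ -
        ∫ x, ramp (-M + j * h) h hh.le x ∂ν| := by
    rw [hg_eq μ, hg_eq ν, add_sub_add_left_eq_sub, ← Finset.sum_sub_distrib]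
    refine (Finset.abs_sum_le_sum_abs _ _).trans (Finset.sum_le_sum fun j _ => ?_)
    rw [← mul_sub, abs_mul]
    refine mul_le_of_le_one_left (abs_nonneg _) ?_
    rw [abs_div, abs_of_pos hh, div_le_one hh]
    have := hf.dist_le_mul (-M + (j + 1) * h) (-M + j * h)
    simp only [Real.dist_eq, NNReal.coe_one, one_mul] at this
    refine this.trans ?_
    rw [show -M + (j + 1) * h - (-M + j * h) = h by ring, abs_of_pos hh]
  have e1 := abs_le.1 (herr μ hμ)
  have e2 := abs_le.1 (herr ν hν)
  have e3 := abs_le.1 hmid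
  rw [abs_le]
  constructor <;> linarith [e1.1, e1.2, e2.1, e2.2, e3.1, e3.2]

/-- Weak convergence together with bounded second moments gives convergence for the bounded
Lipschitz distance. -/
lemma tendsto_boundedLipschitzDist {μ : ℕ → ProbabilityMeasure ℝ} {ν : ProbabilityMeasure ℝ}
    (hlim : Tendsto μ atTop (𝓝 ν)) {C : ℝ} (hC : 0 ≤ C)
    (hμ : ∀ n, ∫⁻ x, ENNReal.ofReal (x ^ 2) ∂(μ n : Measure ℝ) ≤ ENNReal.ofReal C)
    (hν : ∫⁻ x, ENNReal.ofReal (x ^ 2) ∂(ν : Measure ℝ) ≤ ENNReal.ofReal C)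
    {ε : ℝ} (hε : 0 < ε) :
    ∀ᶠ n in atTop, boundedLipschitzDist (μ n) ν ≤ ENNReal.ofReal ε := by
  -- the tails outside `[-M, M]` cost `C / M`, the interpolation inside costs `2 * h`
  obtain ⟨M, hM, hM'⟩ : ∃ M : ℝ, 0 < M ∧ 2 * (C / M) ≤ ε / 4 := by
    refine ⟨8 * (C + 1) / ε, by positivity, ?_⟩
    rw [div_div_eq_mul_div]
    have : C * ε / (8 * (C + 1)) ≤ ε / 8 := by
      rw [div_le_div_iff₀ (by positivity) (by norm_num)]
      nlinarith
    linarith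
  obtain ⟨N, hN⟩ := exists_nat_gt (16 * (2 * M) / ε)
  have hN0 : (0 : ℝ) < N := lt_of_le_of_lt (by positivity) hN
  set h := 2 * M / N with hh_def
  have hh : 0 < h := by positivity
  have hNh : N * h = 2 * M := by rw [hh_def]; field_simp
  have hh4 : 2 * (2 * h) ≤ ε / 4 := by
    rw [div_lt_iff₀ hε] at hN
    have : h ≤ ε / 16 := by
      rw [hh_def, div_le_iff₀ hN0]
      linarith
    linarith
  have hconv : Tendsto (fun n => ∑ j ∈ Finset.range N,
      |∫ x, ramp (-M + j * h) h hh.le x ∂(μ n : Measure ℝ) -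
        ∫ x, ramp (-M + j * h) h hh.le x ∂(ν : Measure ℝ)|) atTop (𝓝 0) := by
    suffices H : Tendsto (fun n => ∑ j ∈ Finset.range N,
        |∫ x, ramp (-M + j * h) h hh.le x ∂(μ n : Measure ℝ) -
          ∫ x, ramp (-M + j * h) h hh.le x ∂(ν : Measure ℝ)|) atTop
        (𝓝 (∑ _j ∈ Finset.range N, (0 : ℝ))) by
      rwa [Finset.sum_const_zero] at H
    refine tendsto_finsetSum _ fun j _ => ?_
    have h1 := (ProbabilityMeasure.tendsto_iff_forall_integral_tendsto.1 hlim)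
      (ramp (-M + j * h) h hh.le)
    simpa using (h1.sub_const (∫ x, ramp (-M + j * h) h hh.le x ∂(ν : Measure ℝ))).abs
  filter_upwards [hconv.eventually_lt_const (half_pos hε)] with n hn
  refine iSup₂_le fun f hf => ENNReal.ofReal_le_ofReal ?_
  have := abs_integral_sub_integral_le hC (hμ n) hν hM hh hNh f hf
  linarith

/-! ### A central limit theorem for weighted centered exponential variables -/

/-- The characteristic function `e^{-iv} / (1 - iv)` of a centered standard exponential variable
agrees with that of the standard normal law up to third order. -/
lemma norm_exp_div_sub_exp_le {v : ℝ} (hv : |v| ≤ 1) :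
    ‖Complex.exp (-(v * Complex.I)) / (1 - v * Complex.I) - Complex.exp (-(v ^ 2 / 2 : ℝ))‖ ≤
      2 * |v| ^ 3 := by
  set w : ℂ := v * Complex.I with hw
  have hwn : ‖w‖ = |v| := by simp [hw]
  have hw2 : (-(v ^ 2 / 2 : ℝ) : ℂ) = w ^ 2 / 2 := by
    rw [hw, mul_pow, Complex.I_sq]; push_cast; ring
  have hden : 1 ≤ ‖1 - w‖ := by
    have := Complex.abs_re_le_norm (1 - w)
    simpa [hw] using this
  have hne : 1 - w ≠ 0 := by rw [hw]; exact one_sub_mul_I_ne_zero v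
  rw [hw2, div_sub' hne, norm_div]
  refine (div_le_self (norm_nonneg _) hden).trans ?_
  have e1 : ‖Complex.exp (-w) - (1 - w + w ^ 2 / 2)‖ ≤ |v| ^ 3 * (2 / 9) := by
    have := Complex.exp_bound (x := -w) (by rw [norm_neg, hwn]; exact hv) (n := 3) (by norm_num)
    rw [norm_neg, hwn] at this
    refine le_trans (le_of_eq ?_) (this.trans (le_of_eq ?_))
    · congr 1
      simp [Finset.sum_range_succ, Nat.factorial]
      ring
    · norm_num [Nat.factorial]
  have e2 : ‖Complex.exp (w ^ 2 / 2) - 1 - w ^ 2 / 2‖ ≤ |v| ^ 4 / 4 := by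
    have hn : ‖w ^ 2 / 2‖ = |v| ^ 2 / 2 := by rw [norm_div, norm_pow, hwn]; simp
    have hv2 : |v| ^ 2 ≤ 1 := pow_le_one₀ (abs_nonneg _) hv
    have := Complex.norm_exp_sub_one_sub_id_le (x := w ^ 2 / 2) (by rw [hn]; linarith)
    rw [hn] at this
    refine this.trans (le_of_eq (by ring))
  have e3 : ‖1 - w‖ ≤ 2 := by
    refine (norm_sub_le _ _).trans ?_
    rw [hwn, norm_one]; linarith
  have hid : Complex.exp (-w) - (1 - w) * Complex.exp (w ^ 2 / 2) =
      (Complex.exp (-w) - (1 - w + w ^ 2 / 2)) -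
        (1 - w) * (Complex.exp (w ^ 2 / 2) - 1 - w ^ 2 / 2) + w ^ 3 / 2 := by ring
  rw [hid]
  have e4 : ‖(1 - w) * (Complex.exp (w ^ 2 / 2) - 1 - w ^ 2 / 2)‖ ≤ 2 * (|v| ^ 4 / 4) := by
    rw [norm_mul]
    exact mul_le_mul e3 e2 (norm_nonneg _) (by norm_num)
  have e5 : ‖w ^ 3 / 2‖ = |v| ^ 3 / 2 := by rw [norm_div, norm_pow, hwn]; simp
  have e6 : |v| ^ 4 ≤ |v| ^ 3 := pow_le_pow_of_le_one (abs_nonneg _) hv (by norm_num)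
  have e7 : 0 ≤ |v| ^ 3 := by positivity
  calc _ ≤ ‖Complex.exp (-w) - (1 - w + w ^ 2 / 2)‖ +
        ‖(1 - w) * (Complex.exp (w ^ 2 / 2) - 1 - w ^ 2 / 2)‖ + ‖w ^ 3 / 2‖ :=
        (norm_add_le _ _).trans (add_le_add_left (norm_sub_le _ _) _)
    _ ≤ 2 * |v| ^ 3 := by rw [e5]; linarith

lemma norm_exp_div_le_one (v : ℝ) :
    ‖Complex.exp (-(v * Complex.I)) / (1 - v * Complex.I)‖ ≤ 1 := by
  rw [norm_div, ← neg_mul, ← Complex.ofReal_neg, Complex.norm_exp_ofReal_mul_I]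
  have := Complex.abs_re_le_norm (1 - v * Complex.I)
  simp only [Complex.sub_re, Complex.one_re, Complex.mul_re, Complex.ofReal_re, Complex.I_re,
    Complex.ofReal_im, Complex.I_im] at this
  norm_num at this
  exact (div_le_one (by linarith)).2 this

lemma norm_prod_sub_prod_le_sum {ι : Type*} (s : Finset ι) (a b : ι → ℂ) (ha : ∀ i, ‖a i‖ ≤ 1)
    (hb : ∀ i, ‖b i‖ ≤ 1) : ‖∏ i ∈ s, a i - ∏ i ∈ s, b i‖ ≤ ∑ i ∈ s, ‖a i - b i‖ := by
  classical
  induction s using Finset.induction_on with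
  | empty => simp
  | insert i s hi ih =>
    rw [Finset.prod_insert hi, Finset.prod_insert hi, Finset.sum_insert hi]
    -- telescoping
    have hid : a i * ∏ j ∈ s, a j - b i * ∏ j ∈ s, b j =
      (a i - b i) * ∏ j ∈ s, a j + b i * (∏ j ∈ s, a j - ∏ j ∈ s, b j) := by ring
    rw [hid]
    refine (norm_add_le _ _).trans (add_le_add ?_ ?_)
    · rw [norm_mul]
      refine mul_le_of_le_one_right (norm_nonneg _) ?_
      rw [norm_prod]
      exact Finset.prod_le_one (fun _ _ => norm_nonneg _) fun j _ => ha j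
    · rw [norm_mul]
      exact (mul_le_of_le_one_left (norm_nonneg _) (hb i)).trans ih

lemma norm_prod_exp_div_sub_exp_le {n : ℕ} (u : Fin n → ℝ) {δ t : ℝ} (hu : ∀ i, |u i| ≤ δ)
    (ht : |t| * δ ≤ 1) :
    ‖∏ i, Complex.exp (-((t * u i : ℝ) * Complex.I)) / (1 - (t * u i : ℝ) * Complex.I) -
      Complex.exp (-(t ^ 2 * (∑ i, u i ^ 2) / 2 : ℝ))‖ ≤ 2 * |t| ^ 3 * δ * ∑ i, u i ^ 2 := by
  have hexp : Complex.exp (-(t ^ 2 * (∑ i, u i ^ 2) / 2 : ℝ)) =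
      ∏ i, Complex.exp (-((t * u i) ^ 2 / 2 : ℝ)) := by
    rw [← Complex.exp_sum]
    congr 1
    push_cast
    rw [Finset.sum_neg_distrib, Finset.mul_sum, Finset.sum_div]
    congr 1
    exact Finset.sum_congr rfl fun i _ => by ring
  rw [hexp]
  refine (norm_prod_sub_prod_le_sum _ _ _ (fun i => norm_exp_div_le_one _) fun i => ?_).trans ?_
  · rw [← Complex.ofReal_neg, Complex.norm_exp_ofReal, Real.exp_le_one_iff]
    have := sq_nonneg (t * u i)
    linarith
  · rw [Finset.mul_sum]
    refine Finset.sum_le_sum fun i _ => ?_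
    have h1 : |t * u i| ≤ 1 := by
      rw [abs_mul]
      exact (mul_le_mul_of_nonneg_left (hu i) (abs_nonneg _)).trans ht
    refine (norm_exp_div_sub_exp_le h1).trans ?_
    rw [abs_mul, ← sq_abs (u i)]
    have : |u i| ^ 3 ≤ δ * |u i| ^ 2 := by
      rw [pow_succ' |u i| 2]
      exact mul_le_mul_of_nonneg_right (hu i) (by positivity)
    calc 2 * (|t| * |u i|) ^ 3 = 2 * |t| ^ 3 * |u i| ^ 3 := by ring
      _ ≤ 2 * |t| ^ 3 * (δ * |u i| ^ 2) := by gcongr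
      _ = _ := by ring

/-- Central limit theorem in uniform form. The measure `μ` stands for the law of
`∑ᵢ uᵢ (Eᵢ - 1)` with `Eᵢ` independent standard exponential; it enters only through its
characteristic function and a bound on its second moment. -/
theorem exists_boundedLipschitzDist_gaussian_le (v : ℝ≥0) {ε : ℝ} (hε : 0 < ε) :
    ∃ δ : ℝ, 0 < δ ∧ ∀ (μ : Measure ℝ) [IsProbabilityMeasure μ] (n : ℕ) (u : Fin n → ℝ),
      |∑ i, u i ^ 2 - v| ≤ δ → (∀ i, |u i| ≤ δ) →
      (∀ t : ℝ, charFun μ t =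
        ∏ i, Complex.exp (-((t * u i : ℝ) * Complex.I)) / (1 - (t * u i : ℝ) * Complex.I)) →
      ∫⁻ x, ENNReal.ofReal (x ^ 2) ∂μ ≤ ENNReal.ofReal (∑ i, u i ^ 2) →
      boundedLipschitzDist μ (gaussianReal 0 v) ≤ ENNReal.ofReal ε := by
  by_contra! hcon
  have hcon' := fun k : ℕ => hcon (1 / ((k : ℝ) + 1)) (by positivity)
  choose μ hμ n u hsum hmax hchar hsq hdist using hcon'
  have hδ : Tendsto (fun k : ℕ => 1 / ((k : ℝ) + 1)) atTop (𝓝 0) :=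
    tendsto_one_div_add_atTop_nhds_zero_nat
  have hδ1 : ∀ k : ℕ, 1 / ((k : ℝ) + 1) ≤ 1 := fun k => by
    rw [div_le_one (by positivity)]
    linarith [(k.cast_nonneg : (0 : ℝ) ≤ k)]
  have hS : Tendsto (fun k => ∑ i, u k i ^ 2) atTop (𝓝 v) := by
    rw [tendsto_iff_dist_tendsto_zero]
    exact squeeze_zero (fun _ => dist_nonneg) (fun k => by rw [Real.dist_eq]; exact hsum k) hδ
  have hS1 : ∀ k, ∑ i, u k i ^ 2 ≤ v + 1 := fun k => by
    have := (abs_le.1 (hsum k)).2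
    linarith [hδ1 k]
  let M : ℕ → ProbabilityMeasure ℝ := fun k => ⟨μ k, hμ k⟩
  let G : ProbabilityMeasure ℝ := ⟨gaussianReal 0 v, inferInstance⟩
  have hweak : Tendsto M atTop (𝓝 G) := by
    refine ProbabilityMeasure.tendsto_of_tendsto_charFun fun t => ?_
    have hG : charFun (G : Measure ℝ) t = Complex.exp (-(t ^ 2 * v / 2 : ℝ)) := by
      change charFun (gaussianReal 0 v) t = _
      rw [charFun_gaussianReal]
      congr 1
      push_cast
      ring
    rw [hG]
    have h1 : Tendsto (fun k => Complex.exp (-(t ^ 2 * (∑ i, u k i ^ 2) / 2 : ℝ))) atTop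
        (𝓝 (Complex.exp (-(t ^ 2 * v / 2 : ℝ)))) := by
      have hc : Continuous fun s : ℝ => Complex.exp (-(t ^ 2 * s / 2 : ℝ)) := by fun_prop
      exact (hc.tendsto _).comp hS
    have h2 : Tendsto (fun k => charFun (M k : Measure ℝ) t -
        Complex.exp (-(t ^ 2 * (∑ i, u k i ^ 2) / 2 : ℝ))) atTop (𝓝 0) := by
      have hb : Tendsto (fun k : ℕ => 2 * |t| ^ 3 * (1 / ((k : ℝ) + 1)) * (v + 1)) atTop (𝓝 0) := by
        simpa using (hδ.const_mul (2 * |t| ^ 3)).mul_const ((v : ℝ) + 1)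
      refine squeeze_zero_norm' ?_ hb
      have ht : Tendsto (fun k : ℕ => |t| * (1 / ((k : ℝ) + 1))) atTop (𝓝 0) := by
        simpa using hδ.const_mul |t|
      filter_upwards [ht.eventually_le_const one_pos] with k hk
      change ‖charFun (μ k) t - _‖ ≤ _
      rw [hchar k t]
      refine (norm_prod_exp_div_sub_exp_le (u k) (hmax k) hk).trans ?_
      gcongr
      exact hS1 k
    simpa using h2.add h1
  have hν : ∫⁻ x, ENNReal.ofReal (x ^ 2) ∂(gaussianReal 0 v) ≤ ENNReal.ofReal (v + 1) := by
    have hi : Integrable (fun x : ℝ => x ^ 2) (gaussianReal 0 v) :=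
      (memLp_id_gaussianReal' 2 (by simp)).integrable_sq
    rw [← ofReal_integral_eq_lintegral_ofReal hi (ae_of_all _ fun x => sq_nonneg x)]
    refine ENNReal.ofReal_le_ofReal ?_
    have := variance_id_gaussianReal (μ := 0) (v := v)
    rw [variance_eq_integral (by fun_prop)] at this
    simp only [id, integral_id_gaussianReal, sub_zero] at this
    rw [this]; linarith
  obtain ⟨k, hk⟩ := (tendsto_boundedLipschitzDist hweak (C := v + 1) (by positivity)
    (fun k => (hsq k).trans (ENNReal.ofReal_le_ofReal (hS1 k))) hν hε).exists
  exact absurd hk (not_le.2 (hdist k))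

/-! ### Real moments of Gamma distributions -/

lemma memLp_id_gammaLaw (a : ℝ≥0) : MemLp id 2 (gammaLaw a) := by
  refine (memLp_two_iff_integrable_sq (by fun_prop)).2 ⟨by fun_prop, ?_⟩
  change HasFiniteIntegral (fun x : ℝ => x ^ 2) _
  rw [hasFiniteIntegral_iff_ofReal (ae_of_all _ fun x => sq_nonneg x), lintegral_gammaLaw_sq]
  exact ENNReal.mul_lt_top ENNReal.coe_lt_top (by simp)

lemma integral_gammaLaw_id (a : ℝ≥0) : ∫ y, y ∂gammaLaw a = a := by
  rw [integral_eq_lintegral_of_nonneg_ae (ae_gammaLaw_nonneg a) (by fun_prop),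
    lintegral_gammaLaw_id, ENNReal.coe_toReal]

lemma variance_id_gammaLaw (a : ℝ≥0) : Var[id; gammaLaw a] = a := by
  rw [variance_eq_sub (memLp_id_gammaLaw a)]
  simp only [Pi.pow_apply, id, integral_gammaLaw_id]
  rw [integral_eq_lintegral_of_nonneg_ae (ae_of_all _ fun x => sq_nonneg x) (by fun_prop),
    lintegral_gammaLaw_sq]
  simp only [ENNReal.toReal_mul, ENNReal.coe_toReal, ← ENNReal.coe_one, ← ENNReal.coe_add,
    NNReal.coe_add, NNReal.coe_one]
  ring

lemma integrable_inv_gammaLaw {a : ℝ≥0} (ha : 0 < a) :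
    Integrable (fun y => y⁻¹) (gammaLaw (a + 1)) := by
  refine ⟨by fun_prop, ?_⟩
  rw [hasFiniteIntegral_iff_ofReal, lintegral_gammaLaw_inv ha]
  · simpa using ha
  · filter_upwards [ae_gammaLaw_nonneg (a + 1)] with y hy using inv_nonneg.2 hy

lemma integral_inv_gammaLaw {a : ℝ≥0} (ha : 0 < a) :
    ∫ y, y⁻¹ ∂gammaLaw (a + 1) = (a : ℝ)⁻¹ := by
  rw [integral_eq_lintegral_of_nonneg_ae _ (by fun_prop), lintegral_gammaLaw_inv ha]
  · simp
  · filter_upwards [ae_gammaLaw_nonneg (a + 1)] with y hy using inv_nonneg.2 hy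

lemma integrable_inv_sq_gammaLaw {a : ℝ≥0} (ha : 0 < a) :
    Integrable (fun y => y⁻¹ ^ 2) (gammaLaw (a + 2)) := by
  refine ⟨by fun_prop, ?_⟩
  rw [hasFiniteIntegral_iff_ofReal (ae_of_all _ fun x => sq_nonneg _),
    lintegral_gammaLaw_inv_sq ha]
  exact ENNReal.mul_lt_top (by simpa using ha) (by simp)

lemma integral_inv_sq_gammaLaw {a : ℝ≥0} (ha : 0 < a) :
    ∫ y, y⁻¹ ^ 2 ∂gammaLaw (a + 2) = (a : ℝ)⁻¹ * ((a : ℝ) + 1)⁻¹ := by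
  rw [integral_eq_lintegral_of_nonneg_ae (ae_of_all _ fun x => sq_nonneg _) (by fun_prop),
    lintegral_gammaLaw_inv_sq ha]
  simp only [ENNReal.toReal_mul, ENNReal.toReal_inv, ENNReal.coe_toReal, ← ENNReal.coe_one,
    ← ENNReal.coe_add, NNReal.coe_add, NNReal.coe_one]

/-- A Gamma variable `T` of large shape is close to its shape, in the sense that `N / T` is close
to one in mean square for every `N` near the shape. -/
lemma lintegral_gammaLaw_ratio_sub_one_sq_le {a : ℝ≥0} (ha : 0 < a) (N : ℝ) :
    ∫⁻ y, ENNReal.ofReal ((N * y⁻¹ - 1) ^ 2) ∂gammaLaw (a + 2) ≤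
      ENNReal.ofReal (((N - a) ^ 2 + 1) / a) := by
  have haR : (0 : ℝ) < a := by exact_mod_cast ha
  have hi1 : Integrable (fun y => y⁻¹) (gammaLaw (a + 2)) := by
    have := integrable_inv_gammaLaw (a := a + 1) (by positivity)
    rwa [add_assoc, one_add_one_eq_two] at this
  have he1 : ∫ y, y⁻¹ ∂gammaLaw (a + 2) = ((a : ℝ) + 1)⁻¹ := by
    have := integral_inv_gammaLaw (a := a + 1) (by positivity)
    rwa [add_assoc, one_add_one_eq_two, NNReal.coe_add, NNReal.coe_one] at this
  have hi2 := integrable_inv_sq_gammaLaw ha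
  have hexp : (fun y : ℝ => (N * y⁻¹ - 1) ^ 2) =
      fun y => N ^ 2 * y⁻¹ ^ 2 - 2 * N * y⁻¹ + 1 := by
    funext y; ring
  have hi3 : Integrable (fun y : ℝ => N ^ 2 * y⁻¹ ^ 2 - 2 * N * y⁻¹) (gammaLaw (a + 2)) :=
    (hi2.const_mul _).sub (hi1.const_mul _)
  have hi : Integrable (fun y : ℝ => (N * y⁻¹ - 1) ^ 2) (gammaLaw (a + 2)) := by
    rw [hexp]
    exact hi3.add (integrable_const _)
  rw [← ofReal_integral_eq_lintegral_ofReal hi (ae_of_all _ fun y => sq_nonneg _)]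
  refine ENNReal.ofReal_le_ofReal ?_
  rw [hexp, integral_add hi3 (integrable_const _),
    integral_sub (hi2.const_mul _) (hi1.const_mul _), integral_const_mul, integral_const_mul,
    integral_inv_sq_gammaLaw ha, he1]
  simp only [integral_const, probReal_univ, one_smul]
  have h1 : N ^ 2 * ((a : ℝ)⁻¹ * ((a : ℝ) + 1)⁻¹) - 2 * N * ((a : ℝ) + 1)⁻¹ + 1 =
      ((N - a) ^ 2 + a) / (a * (a + 1)) := by
    field_simp
    ring
  rw [h1, div_le_div_iff₀ (by positivity) haR]
  have : 0 ≤ (N - a) ^ 2 * (a : ℝ) ^ 2 := by positivity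
  nlinarith [haR]

/-! ### Linear functionals of Dirichlet vectors -/

section Dirichlet

variable {k : ℕ}

/-- Independent Gamma vectors add up coordinatewise. -/
lemma map_add_prod_pi_gammaLaw (p m : Fin k → ℝ≥0) :
    ((Measure.pi fun j => gammaLaw (p j)).prod (Measure.pi fun j => gammaLaw (m j))).map
      (fun s j => s.1 j + s.2 j) = Measure.pi fun j => gammaLaw (p j + m j) := by
  have e := measurePreserving_arrowProdEquivProdArrow ℝ ℝ (Fin k) (fun j => gammaLaw (p j))
    (fun j => gammaLaw (m j))
  rw [← e.map_eq, Measure.map_map (by fun_prop) e.measurable]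
  have h : ∀ j, ((gammaLaw (p j)).prod (gammaLaw (m j))).map (fun x : ℝ × ℝ => x.1 + x.2) =
      gammaLaw (p j + m j) := fun j => by
    rw [← gammaLaw_conv, Measure.conv]
  have : ∀ j, IsProbabilityMeasure
      (((gammaLaw (p j)).prod (gammaLaw (m j))).map (fun x : ℝ × ℝ => x.1 + x.2)) := fun j => by
    rw [h j]; infer_instance
  have hpi := Measure.pi_map_pi (μ := fun j => (gammaLaw (p j)).prod (gammaLaw (m j)))
    (f := fun _ (x : ℝ × ℝ) => x.1 + x.2) (fun j => by fun_prop)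
  simp_rw [h] at hpi
  exact hpi

lemma measurable_normalize : Measurable fun (y : Fin k → ℝ) i => y i / ∑ j, y j := by fun_prop

/-- The law of a linear functional of a Dirichlet vector, written on the product of two
independent Gamma vectors whose sum is normalized. -/
lemma map_dirichletLaw_add (p m : Fin k → ℝ≥0) (b : Fin k → ℝ) (N : ℝ) :
    (dirichletLaw fun j => p j + m j).map (fun w => N * ∑ j, b j * w j) =
      ((Measure.pi fun j => gammaLaw (p j)).prod (Measure.pi fun j => gammaLaw (m j))).map
        fun s => (∑ j, b j * s.1 j + ∑ j, b j * s.2 j) * (N * (∑ j, (s.1 j + s.2 j))⁻¹) := by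
  rw [dirichletLaw, ← map_add_prod_pi_gammaLaw, Measure.map_map (by fun_prop) (by fun_prop),
    Measure.map_map (by fun_prop) (by fun_prop)]
  congr 1
  funext s
  simp only [Function.comp_apply, ← Finset.sum_add_distrib, ← mul_add, Finset.mul_sum,
    Finset.sum_mul]
  exact Finset.sum_congr rfl fun j _ => by rw [div_eq_mul_inv]; ring

lemma charFun_map_weighted_sum_gammaLaw (m : Fin k → ℕ) (b : Fin k → ℝ) (t : ℝ) :
    charFun ((Measure.pi fun j => gammaLaw (m j)).map fun w => ∑ j, b j * w j) t =
      ∏ j, ((1 - (t * b j : ℝ) * Complex.I) ^ m j)⁻¹ := by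
  have : ∀ j, IsProbabilityMeasure ((gammaLaw (m j)).map (fun x : ℝ => b j * x)) := fun j =>
    Measure.isProbabilityMeasure_map (by fun_prop)
  have hpi := Measure.pi_map_pi (μ := fun j => gammaLaw (m j))
    (f := fun j (x : ℝ) => b j * x) (fun j => by fun_prop)
  have hcomp : (Measure.pi fun j => gammaLaw (m j)).map (fun w => ∑ j, b j * w j) =
      (Measure.pi fun j => (gammaLaw (m j)).map (fun x : ℝ => b j * x)).map
        (fun w => ∑ j, w j) := by
    rw [← hpi, Measure.map_map (by fun_prop) (by fun_prop)]
    rfl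
  rw [hcomp, charFun_map_sum_pi_eq_prod, Finset.prod_apply]
  refine Finset.prod_congr rfl fun j _ => ?_
  rw [charFun_map_mul, charFun_gammaLaw_nat, mul_comm t]

lemma lintegral_weighted_sum_gammaLaw_sq (m : Fin k → ℝ≥0) (b : Fin k → ℝ)
    (hb : ∑ j, b j * m j = 0) :
    ∫⁻ w, ENNReal.ofReal ((∑ j, b j * w j) ^ 2) ∂(Measure.pi fun j => gammaLaw (m j)) =
      ENNReal.ofReal (∑ j, b j ^ 2 * m j) := by
  have hL : ∀ j, MemLp (fun x : ℝ => b j * x) 2 (gammaLaw (m j)) := fun j =>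
    (memLp_id_gammaLaw (m j)).const_mul (b j)
  have hLp : ∀ j, MemLp (fun w : Fin k → ℝ => b j * w j) 2
      (Measure.pi fun j => gammaLaw (m j)) := fun j =>
    (hL j).comp_measurePreserving (measurePreserving_eval _ j)
  have hsum : MemLp (fun w : Fin k → ℝ => ∑ j, b j * w j) 2
      (Measure.pi fun j => gammaLaw (m j)) := memLp_finsetSum _ fun j _ => hLp j
  rw [← ofReal_integral_eq_lintegral_ofReal hsum.integrable_sq (ae_of_all _ fun _ => sq_nonneg _)]
  congr 1
  have hmean : ∫ w, ∑ j, b j * w j ∂(Measure.pi fun j => gammaLaw (m j)) = 0 := by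
    rw [integral_finsetSum _ fun j _ => (hLp j).integrable (by norm_num), ← hb]
    refine Finset.sum_congr rfl fun j _ => ?_
    rw [integral_const_mul]
    congr 1
    have := integral_map (μ := Measure.pi fun j => gammaLaw (m j)) (φ := Function.eval j)
      (measurable_pi_apply j).aemeasurable (f := fun x : ℝ => x) (by fun_prop)
    rw [(measurePreserving_eval _ j).map_eq, integral_gammaLaw_id] at this
    exact this.symm
  have hvar := variance_sum_pi (μ := fun j => gammaLaw (m j)) hL
  rw [show (∑ j, fun w : Fin k → ℝ => b j * w j) = fun w => ∑ j, b j * w j by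
    funext w; simp, variance_eq_sub hsum, hmean] at hvar
  simp only [Pi.pow_apply] at hvar
  rw [zero_pow two_ne_zero, sub_zero] at hvar
  rw [hvar]
  refine Finset.sum_congr rfl fun j _ => ?_
  rw [variance_const_mul]
  congr 1
  exact variance_id_gammaLaw _

lemma lintegral_abs_weighted_sum_gammaLaw_le (p : Fin k → ℝ≥0) (b : Fin k → ℝ) :
    ∫⁻ w, ENNReal.ofReal |∑ j, b j * w j| ∂(Measure.pi fun j => gammaLaw (p j)) ≤
      ENNReal.ofReal (∑ j, |b j| * p j) := by
  have h1 : ∀ j, ∫⁻ w, ENNReal.ofReal |b j * w j| ∂(Measure.pi fun j => gammaLaw (p j)) =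
      ENNReal.ofReal (|b j| * p j) := fun j => by
    have := lintegral_map (μ := Measure.pi fun j => gammaLaw (p j)) (g := Function.eval j)
      (f := fun x : ℝ => ENNReal.ofReal |b j * x|) (by fun_prop) (measurable_pi_apply j)
    rw [(measurePreserving_eval _ j).map_eq] at this
    refine this.symm.trans ?_
    rw [ENNReal.ofReal_mul (abs_nonneg _), ENNReal.ofReal_coe_nnreal, ← lintegral_gammaLaw_id,
      ← lintegral_const_mul _ (by fun_prop)]
    refine lintegral_congr_ae ?_
    filter_upwards [ae_gammaLaw_nonneg (p j)] with y hy
    rw [abs_mul, abs_of_nonneg hy, ENNReal.ofReal_mul (abs_nonneg _)]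
  calc _ ≤ ∫⁻ w, ∑ j, ENNReal.ofReal |b j * w j| ∂(Measure.pi fun j => gammaLaw (p j)) := by
        refine lintegral_mono fun w => ?_
        rw [← ENNReal.ofReal_sum_of_nonneg fun _ _ => abs_nonneg _]
        exact ENNReal.ofReal_le_ofReal (Finset.abs_sum_le_sum_abs _ _)
    _ = _ := by
        rw [lintegral_finsetSum _ fun j _ => by fun_prop,
          ENNReal.ofReal_sum_of_nonneg fun j _ => by positivity]
        exact Finset.sum_congr rfl fun j _ => h1 j

lemma ae_pi_gammaLaw_nonneg (p : Fin k → ℝ≥0) :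
    ∀ᵐ w ∂(Measure.pi fun j => gammaLaw (p j)), ∀ j, 0 ≤ w j := by
  rw [ae_all_iff]
  exact fun j => (measurePreserving_eval _ j).quasiMeasurePreserving.ae (ae_gammaLaw_nonneg (p j))

lemma ae_pi_gammaLaw_sum_pos (p : Fin k → ℝ≥0) (hp : 0 < ∑ j, p j) :
    ∀ᵐ w ∂(Measure.pi fun j => gammaLaw (p j)), 0 < ∑ j, w j := by
  have h := ae_gammaLaw_pos hp
  rw [← map_sum_pi_gammaLaw] at h
  exact ae_of_ae_map (by fun_prop) h

/-- A normalized linear functional of a Dirichlet vector with parameters `p + m` is close to the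
corresponding centered linear functional of independent Gamma variables with shapes `m`. -/
lemma boundedLipschitzDist_dirichletLaw_le (p m : Fin k → ℝ≥0) {n : ℕ} (hn : 3 ≤ n)
    (hm : ∑ j, m j = n) (b : Fin k → ℝ) (hb : ∑ j, b j * m j = 0) {κ : ℝ} (hκ : 0 < κ) :
    boundedLipschitzDist ((dirichletLaw fun j => p j + m j).map fun w => n * ∑ j, b j * w j)
      ((Measure.pi fun j => gammaLaw (m j)).map fun w => ∑ j, b j * w j) ≤
      ENNReal.ofReal (κ * ∑ j, b j ^ 2 * m j +
        κ⁻¹ * (((2 - ∑ j, (p j : ℝ)) ^ 2 + 1) / (n - 2)) + 2 * ∑ j, |b j| * p j) := by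
  set U := Measure.pi fun j => gammaLaw (p j) with hU
  set W := Measure.pi fun j => gammaLaw (m j) with hW
  have hnR : (3 : ℝ) ≤ n := by exact_mod_cast hn
  set S : (Fin k → ℝ) × (Fin k → ℝ) → ℝ := fun s => ∑ j, (s.1 j + s.2 j) with hS
  have hsnd : W.map (fun w => ∑ j, b j * w j) = (U.prod W).map fun s => ∑ j, b j * s.2 j := by
    have : W = (U.prod W).map Prod.snd := by simp
    conv_lhs => rw [this]
    rw [Measure.map_map (by fun_prop) (by fun_prop)]
    rfl
  have hSm : Measurable S := by fun_prop
  have hSlaw : (U.prod W).map S = gammaLaw (∑ j, p j + n) := by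
    have h1 := map_sum_pi_gammaLaw fun j => p j + m j
    rw [← map_add_prod_pi_gammaLaw, Measure.map_map (by fun_prop) (by fun_prop),
      Finset.sum_add_distrib, hm] at h1
    exact h1
  rw [map_dirichletLaw_add, hsnd]
  refine (boundedLipschitzDist_map_le _ (by fun_prop) (by fun_prop)).trans ?_
  have hU0 : ∀ᵐ s ∂U.prod W, ∀ j, 0 ≤ s.1 j :=
    Measure.quasiMeasurePreserving_fst.ae (ae_pi_gammaLaw_nonneg p)
  have hWpos : ∀ᵐ s ∂U.prod W, 0 < ∑ j, s.2 j :=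
    Measure.quasiMeasurePreserving_snd.ae (ae_pi_gammaLaw_sum_pos m (by
      rw [hm]; exact_mod_cast (by omega : 0 < n)))
  have hpt : ∀ᵐ s ∂U.prod W, ENNReal.ofReal
      |(∑ j, b j * s.1 j + ∑ j, b j * s.2 j) * (n * (∑ j, (s.1 j + s.2 j))⁻¹) -
        ∑ j, b j * s.2 j| ≤
      ENNReal.ofReal κ * ENNReal.ofReal ((∑ j, b j * s.2 j) ^ 2) +
        ENNReal.ofReal κ⁻¹ * ENNReal.ofReal ((n * (S s)⁻¹ - 1) ^ 2) +
        ENNReal.ofReal n * (ENNReal.ofReal |∑ j, b j * s.1 j| *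
          ENNReal.ofReal (∑ j, s.2 j)⁻¹) := by
    filter_upwards [hU0, hWpos] with s h1 h2
    have hST : ∑ j, s.2 j ≤ S s := by
      rw [hS]
      exact Finset.sum_le_sum fun j _ => by linarith [h1 j]
    -- dropping the prior mass from the total makes the two factors of the last term independent
    have hTinv : (S s)⁻¹ ≤ (∑ j, s.2 j)⁻¹ := inv_anti₀ h2 hST
    have hTpos : 0 < (S s)⁻¹ := inv_pos.2 (h2.trans_le hST)
    rw [← ENNReal.ofReal_mul hκ.le, ← ENNReal.ofReal_mul (inv_nonneg.2 hκ.le),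
      ← ENNReal.ofReal_mul (abs_nonneg _), ← ENNReal.ofReal_mul (by positivity),
      ← ENNReal.ofReal_add (by positivity) (by positivity),
      ← ENNReal.ofReal_add (by positivity) (by positivity)]
    refine ENNReal.ofReal_le_ofReal ?_
    change |(∑ j, b j * s.1 j + ∑ j, b j * s.2 j) * (n * (S s)⁻¹) - ∑ j, b j * s.2 j| ≤ _
    generalize (∑ j, b j * s.1 j) = x2
    generalize (∑ j, b j * s.2 j) = x1
    generalize (∑ j, s.2 j)⁻¹ = w at *
    generalize (S s)⁻¹ = τ at *
    have e1 : (x2 + x1) * (n * τ) - x1 = x1 * (n * τ - 1) + x2 * (n * τ) := by ring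
    rw [e1]
    refine (abs_add_le _ _).trans (add_le_add ?_ ?_)
    -- weighted AM-GM; `κ` is chosen later to balance the two squares
    · rw [abs_mul, ← sq_abs x1, ← sq_abs (n * τ - 1)]
      have h3 : κ * |x1| ^ 2 + κ⁻¹ * |n * τ - 1| ^ 2 - 2 * (|x1| * |n * τ - 1|) =
          κ⁻¹ * (κ * |x1| - |n * τ - 1|) ^ 2 := by
        field_simp
        ring
      have h4 : 0 ≤ κ⁻¹ * (κ * |x1| - |n * τ - 1|) ^ 2 := by positivity
      have h5 : 0 ≤ |x1| * |n * τ - 1| := by positivity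
      linarith
    · rw [abs_mul, abs_of_pos (by positivity : (0 : ℝ) < n * τ)]
      calc |x2| * (n * τ) = n * (|x2| * τ) := by ring
        _ ≤ n * (|x2| * w) := by gcongr
  refine (lintegral_mono_ae hpt).trans ?_
  rw [lintegral_add_left (by fun_prop), lintegral_add_left (by fun_prop),
    lintegral_const_mul _ (by fun_prop), lintegral_const_mul _ (by fun_prop),
    lintegral_const_mul _ (by fun_prop)]
  have hI1 : ∫⁻ s, ENNReal.ofReal ((∑ j, b j * s.2 j) ^ 2) ∂U.prod W =
      ENNReal.ofReal (∑ j, b j ^ 2 * m j) := by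
    rw [← lintegral_weighted_sum_gammaLaw_sq m b hb, ← hW]
    have : W = (U.prod W).map Prod.snd := by simp
    conv_rhs => rw [this]
    rw [lintegral_map (by fun_prop) (by fun_prop)]
  have hI2 : ∫⁻ s, ENNReal.ofReal ((n * (S s)⁻¹ - 1) ^ 2) ∂U.prod W ≤
      ENNReal.ofReal (((2 - ∑ j, (p j : ℝ)) ^ 2 + 1) / (n - 2)) := by
    have h1 := lintegral_map (μ := U.prod W)
      (f := fun y : ℝ => ENNReal.ofReal ((n * y⁻¹ - 1) ^ 2)) (by fun_prop) hSm
    rw [← h1, hSlaw]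
    obtain ⟨d, rfl⟩ : ∃ d, n = d + 2 := ⟨n - 2, by omega⟩
    have hd : 0 < d := by omega
    have hdR : (0 : ℝ) < d := by exact_mod_cast hd
    have e : ∑ j, p j + ((d + 2 : ℕ) : ℝ≥0) = (∑ j, p j + d) + 2 := by push_cast; ring
    rw [e]
    refine (lintegral_gammaLaw_ratio_sub_one_sq_le (by positivity) _).trans
      (ENNReal.ofReal_le_ofReal ?_)
    push_cast
    rw [show ((d : ℝ) + 2 - (∑ j, (p j : ℝ) + d)) = 2 - ∑ j, (p j : ℝ) by ring,
      add_sub_cancel_right]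
    gcongr
    have : 0 ≤ ∑ j, (p j : ℝ) := Finset.sum_nonneg fun _ _ => NNReal.coe_nonneg _
    linarith
  have hI3 : ENNReal.ofReal n * ∫⁻ s, ENNReal.ofReal |∑ j, b j * s.1 j| *
      ENNReal.ofReal (∑ j, s.2 j)⁻¹ ∂U.prod W ≤ ENNReal.ofReal (2 * ∑ j, |b j| * p j) := by
    rw [lintegral_prod_mul (f := fun u : Fin k → ℝ => ENNReal.ofReal |∑ j, b j * u j|)
      (g := fun u : Fin k → ℝ => ENNReal.ofReal (∑ j, u j)⁻¹)
      (Measurable.aemeasurable (by fun_prop)) (by fun_prop)]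
    have h1 := lintegral_map (μ := W) (f := fun y : ℝ => ENNReal.ofReal y⁻¹)
      (g := fun u => ∑ j, u j) (by fun_prop) (by fun_prop)
    rw [map_sum_pi_gammaLaw, hm] at h1
    obtain ⟨d, rfl⟩ : ∃ d, n = d + 1 := ⟨n - 1, by omega⟩
    have hd : 0 < d := by omega
    have hdR : (0 : ℝ) < d := by exact_mod_cast hd
    rw [Nat.cast_add, Nat.cast_one, lintegral_gammaLaw_inv (by positivity)] at h1
    rw [← h1, ← ENNReal.ofReal_coe_nnreal, ← ENNReal.ofReal_inv_of_pos (by positivity)]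
    calc _ ≤ ENNReal.ofReal ((d + 1 : ℕ) : ℝ) * (ENNReal.ofReal (∑ j, |b j| * p j) *
          ENNReal.ofReal ((d : ℝ≥0) : ℝ)⁻¹) := by
          gcongr
          exact lintegral_abs_weighted_sum_gammaLaw_le p b
      _ ≤ _ := by
          have hs : 0 ≤ ∑ j, |b j| * (p j : ℝ) := Finset.sum_nonneg fun j _ => by positivity
          rw [← ENNReal.ofReal_mul hs, ← ENNReal.ofReal_mul (by positivity)]
          refine ENNReal.ofReal_le_ofReal ?_
          have hd1 : ((d + 1 : ℕ) : ℝ) * ((d : ℝ≥0) : ℝ)⁻¹ ≤ 2 := by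
            push_cast
            rw [← div_eq_mul_inv, div_le_iff₀ hdR]
            have : (1 : ℝ) ≤ d := by exact_mod_cast hd
            linarith
          calc _ = (((d + 1 : ℕ) : ℝ) * ((d : ℝ≥0) : ℝ)⁻¹) * ∑ j, |b j| * (p j : ℝ) := by ring
            _ ≤ _ := by gcongr
  have hq : (0 : ℝ) ≤ ((2 - ∑ j, (p j : ℝ)) ^ 2 + 1) / (n - 2) :=
    div_nonneg (by positivity) (by linarith)
  have hs1 : 0 ≤ ∑ j, b j ^ 2 * (m j : ℝ) := Finset.sum_nonneg fun j _ => by positivity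
  have hs2 : 0 ≤ ∑ j, |b j| * (p j : ℝ) := Finset.sum_nonneg fun j _ => by positivity
  rw [hI1, ENNReal.ofReal_add (by positivity) (by positivity),
    ENNReal.ofReal_add (by positivity) (by positivity), ENNReal.ofReal_mul hκ.le,
    ENNReal.ofReal_mul (inv_nonneg.2 hκ.le)]
  gcongr

/-- The mean of the first coordinate of a Dirichlet vector of length two. Size-biasing turns the
ratio into the inverse of a Gamma variable of shape `q 0 + q 1 + 1`. -/
lemma lintegral_dirichletLaw_two (q : Fin 2 → ℝ≥0) (hq : 0 < q 0 + q 1) :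
    ∫⁻ w, ENNReal.ofReal (w 0) ∂dirichletLaw q = (q 0 : ℝ≥0∞) * ((q 0 + q 1 : ℝ≥0) : ℝ≥0∞)⁻¹ := by
  rw [dirichletLaw, lintegral_map (by fun_prop) measurable_normalize]
  have e := measurePreserving_piFinTwo fun i => gammaLaw (q i)
  have h1 := lintegral_map (μ := Measure.pi fun i => gammaLaw (q i))
    (f := fun s : ℝ × ℝ => ENNReal.ofReal (s.1 / (s.1 + s.2))) (by fun_prop) e.measurable
  rw [e.map_eq] at h1
  have h2 : ∫⁻ y, ENNReal.ofReal (y 0 / ∑ j, y j) ∂(Measure.pi fun i => gammaLaw (q i)) =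
      ∫⁻ s, ENNReal.ofReal (s.1 / (s.1 + s.2)) ∂(gammaLaw (q 0)).prod (gammaLaw (q 1)) := by
    rw [h1]
    refine lintegral_congr fun y => ?_
    simp [Fin.sum_univ_two, MeasurableEquiv.piFinTwo]
  rw [h2, lintegral_prod_symm _ (by fun_prop)]
  have h3 : ∀ y, ∫⁻ x, ENNReal.ofReal (x / (x + y)) ∂gammaLaw (q 0) =
      q 0 * ∫⁻ x, ENNReal.ofReal (x + y)⁻¹ ∂gammaLaw (q 0 + 1) := fun y => by
    rw [← lintegral_gammaLaw_size_bias _ (by fun_prop)]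
    refine lintegral_congr_ae ?_
    filter_upwards [ae_gammaLaw_nonneg (q 0)] with x hx
    rw [div_eq_mul_inv, ENNReal.ofReal_mul hx]
  simp only [h3]
  rw [lintegral_const_mul _ (by fun_prop), ← lintegral_prod_symm
    (μ := gammaLaw (q 0 + 1)) (ν := gammaLaw (q 1))
    (fun s : ℝ × ℝ => ENNReal.ofReal (s.1 + s.2)⁻¹) (by fun_prop)]
  have h4 := lintegral_map (μ := (gammaLaw (q 0 + 1)).prod (gammaLaw (q 1)))
    (f := fun y : ℝ => ENNReal.ofReal y⁻¹) (g := fun s : ℝ × ℝ => s.1 + s.2)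
    (by fun_prop) (by fun_prop)
  rw [← h4]
  change _ * lintegral (gammaLaw (q 0 + 1) ∗ gammaLaw (q 1)) _ = _
  rw [gammaLaw_conv, add_right_comm, lintegral_gammaLaw_inv hq]

end Dirichlet

/-! ### The mean of a Dirichlet process -/

section DirichletProcess

variable {X : Type*} [MeasurableSpace X]

lemma measurable_measureReal_coe {A : Set X} (hA : MeasurableSet A) :
    Measurable fun G : ProbabilityMeasure X => (G : Measure X).real A :=
  ((Measure.measurable_coe hA).comp measurable_subtype_coe).ennreal_toReal

lemma measurable_lintegral_coe {h : X → ℝ≥0∞} (hh : Measurable h) :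
    Measurable fun G : ProbabilityMeasure X => ∫⁻ x, h x ∂(G : Measure X) :=
  (Measure.measurable_lintegral hh).comp measurable_subtype_coe

lemma IsDirichletProcess.lintegral_apply {β : Measure X} [IsFiniteMeasure β] (hβ : β ≠ 0)
    {Q : Measure (ProbabilityMeasure X)} (hQ : IsDirichletProcess β Q) {A : Set X}
    (hA : MeasurableSet A) :
    ∫⁻ G, (G : Measure X) A ∂Q = (β Set.univ)⁻¹ * β A := by
  have hmeas : ∀ i : Fin 2, MeasurableSet ((![A, Aᶜ] : Fin 2 → Set X) i) := by
    intro i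
    fin_cases i
    exacts [hA, hA.compl]
  have hmap := hQ.map_partition 2 ![A, Aᶜ] hmeas (by
    intro i j hij
    fin_cases i <;> fin_cases j <;> first | exact absurd rfl hij | skip
    · exact disjoint_compl_right
    · exact disjoint_compl_left) (by
    ext x
    simp only [Set.mem_iUnion, Fin.exists_fin_two, Set.mem_univ, iff_true]
    exact em (x ∈ A))
  have hsum : (β A).toNNReal + (β Aᶜ).toNNReal = (β Set.univ).toNNReal := by
    rw [← ENNReal.toNNReal_add (measure_ne_top _ _) (measure_ne_top _ _),
      measure_add_measure_compl hA]
  have hpos : 0 < (β Set.univ).toNNReal :=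
    ENNReal.toNNReal_pos (by simpa using hβ) (measure_ne_top _ _)
  have h1 := lintegral_dirichletLaw_two (fun i => (β (![A, Aᶜ] i)).toNNReal)
    (by simpa [hsum] using hpos)
  rw [← hmap, lintegral_map (by fun_prop)
    (measurable_pi_lambda _ fun i => measurable_measureReal_coe (hmeas i))] at h1
  simp only [Matrix.cons_val_zero, Matrix.cons_val_one, hsum,
    ENNReal.coe_toNNReal (measure_ne_top β _)] at h1
  rw [mul_comm, ← h1]
  refine lintegral_congr fun G => ?_
  exact (ofReal_measureReal).symm

/-- The mean of a Dirichlet process is its normalized base measure. -/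
lemma IsDirichletProcess.lintegral_lintegral {β : Measure X} [IsFiniteMeasure β] (hβ : β ≠ 0)
    {Q : Measure (ProbabilityMeasure X)} (hQ : IsDirichletProcess β Q) {h : X → ℝ≥0∞}
    (hh : Measurable h) :
    ∫⁻ G, ∫⁻ x, h x ∂(G : Measure X) ∂Q = (β Set.univ)⁻¹ * ∫⁻ x, h x ∂β := by
  have hcoe : Measurable fun G : ProbabilityMeasure X => (G : Measure X) := measurable_subtype_coe
  have hjoin : Measure.join (Q.map fun G : ProbabilityMeasure X => (G : Measure X)) =
      (β Set.univ)⁻¹ • β := by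
    ext A hA
    rw [Measure.join_apply hA, lintegral_map (Measure.measurable_coe hA) hcoe,
      hQ.lintegral_apply hβ hA, Measure.smul_apply, smul_eq_mul]
  have h1 := Measure.lintegral_join (m := Q.map fun G : ProbabilityMeasure X => (G : Measure X))
    hh.aemeasurable
  rw [hjoin, lintegral_smul_measure, lintegral_map (Measure.measurable_lintegral hh) hcoe] at h1
  exact h1.symm

lemma IsDirichletProcess.ae_integrable {β : Measure X} [IsFiniteMeasure β] (hβ : β ≠ 0)
    {Q : Measure (ProbabilityMeasure X)} (hQ : IsDirichletProcess β Q) {f : X → ℝ}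
    (hf : Measurable f) (hfi : Integrable f β) :
    ∀ᵐ G : ProbabilityMeasure X ∂Q, Integrable f (G : Measure X) := by
  have h1 := hQ.lintegral_lintegral hβ (h := fun x => ‖f x‖ₑ) (by fun_prop)
  have h2 : ∫⁻ G : ProbabilityMeasure X, ∫⁻ x, ‖f x‖ₑ ∂(G : Measure X) ∂Q ≠ ∞ := by
    rw [h1]
    refine ENNReal.mul_ne_top ?_ hfi.2.ne
    simpa using hβ
  filter_upwards [ae_lt_top (measurable_lintegral_coe (by fun_prop)) h2] with G hG
  exact ⟨hf.aestronglyMeasurable, hG⟩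

/-- Bochner integrals depend measurably on the measure, since the inclusion of probability measures
into measures is a Markov kernel. -/
lemma measurable_integral_coe {f : X → ℝ} (hf : Measurable f) :
    Measurable fun G : ProbabilityMeasure X => ∫ x, f x ∂(G : Measure X) := by
  have h : StronglyMeasurable fun G : ProbabilityMeasure X => ∫ x, f x ∂(G : Measure X) := by
    let K : Kernel (ProbabilityMeasure X) X := ⟨fun G => (G : Measure X), measurable_subtype_coe⟩
    have : IsMarkovKernel K := ⟨fun G => inferInstanceAs (IsProbabilityMeasure (G : Measure X))⟩
    exact StronglyMeasurable.integral_kernel (κ := K) hf.stronglyMeasurable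
  exact h.measurable

end DirichletProcess

/-! ### Finitely valued approximations -/

lemma integral_comp_eq_sum_of_finite_values {X : Type*} [MeasurableSpace X] (ν : Measure X)
    [IsFiniteMeasure ν] {k : ℕ} {h : X → ℝ} (hh : Measurable h) {y : Fin k → ℝ}
    (hy : Function.Injective y) (hhy : ∀ x, ∃ j, h x = y j) (φ : ℝ → ℝ) :
    Integrable (fun x => φ (h x)) ν ∧
      ∫ x, φ (h x) ∂ν = ∑ j, φ (y j) * ν.real (h ⁻¹' {y j}) := by
  have hA : ∀ j, MeasurableSet (h ⁻¹' {y j}) := fun j => hh (measurableSet_singleton _)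
  have heq : (fun x => φ (h x)) =
      fun x => ∑ j, (h ⁻¹' {y j}).indicator (fun _ => φ (y j)) x := by
    funext x
    obtain ⟨i, hi⟩ := hhy x
    rw [Finset.sum_eq_single i]
    · rw [Set.indicator_of_mem (by simp [hi]), hi]
    · intro j _ hj
      refine Set.indicator_of_notMem ?_ _
      simp only [Set.mem_preimage, Set.mem_singleton_iff, hi]
      exact fun e => hj (hy e).symm
    · simp
  have hi : ∀ j, Integrable ((h ⁻¹' {y j}).indicator (fun _ => φ (y j))) ν := fun j =>
    (integrable_const _).indicator (hA j)
  rw [heq]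
  refine ⟨integrable_finsetSum _ fun j _ => hi j, ?_⟩
  rw [integral_finsetSum _ fun j _ => hi j]
  refine Finset.sum_congr rfl fun j _ => ?_
  rw [integral_indicator_const _ (hA j), smul_eq_mul, mul_comm]

/-- Approximation in mean by finitely valued functions that keep the values at given points. -/
lemma exists_finite_valued_approx {β : Measure ℝ} {f : ℝ → ℝ} (hf : Measurable f)
    (hfi : Integrable f β) {n : ℕ} (z : Fin n → ℝ) {η : ℝ} (hη : 0 < η) :
    ∃ (k : ℕ) (y : Fin k → ℝ) (h : ℝ → ℝ), Function.Injective y ∧ Measurable h ∧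
      (∀ x, ∃ j, h x = y j) ∧ (∀ i, h (z i) = f (z i)) ∧
      ∫⁻ x, ‖f x - h x‖ₑ ∂β ≤ ENNReal.ofReal η := by
  obtain ⟨g, hg, -⟩ := (memLp_one_iff_integrable.2 hfi).exists_simpleFunc_eLpNorm_sub_lt
    ENNReal.one_ne_top (ε := ENNReal.ofReal η) (by simpa using hη)
  rw [eLpNorm_one_eq_lintegral_enorm] at hg
  classical
  set S : Set ℝ := Set.range z with hS
  have hSf : S.Finite := Set.finite_range z
  set h : ℝ → ℝ := S.piecewise f g with hh
  have hrange : (Set.range h).Finite := by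
    refine ((hSf.image f).union g.finite_range).subset ?_
    rintro _ ⟨x, rfl⟩
    by_cases hx : x ∈ S
    · left; rw [hh, Set.piecewise_eq_of_mem _ _ _ hx]; exact Set.mem_image_of_mem f hx
    · right; rw [hh, Set.piecewise_eq_of_notMem _ _ _ hx]; exact Set.mem_range_self x
  set e := hrange.toFinset.equivFin with he
  refine ⟨hrange.toFinset.card, fun j => (e.symm j : ℝ), h, ?_, ?_, ?_, ?_, ?_⟩
  · exact Subtype.val_injective.comp e.symm.injective
  · exact hf.piecewise hSf.measurableSet g.measurable
  · intro x
    refine ⟨e ⟨h x, by simp⟩, by simp⟩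
  · intro i
    exact Set.piecewise_eq_of_mem _ _ _ (Set.mem_range_self i)
  · refine (lintegral_mono fun x => ?_).trans hg.le
    by_cases hx : x ∈ S
    · rw [hh, Set.piecewise_eq_of_mem _ _ _ hx]; simp
    · rw [hh, Set.piecewise_eq_of_notMem _ _ _ hx]; rfl

/-! ### The posterior law of a linear functional -/

instance isFiniteMeasure_posteriorBase (α : Measure ℝ) [IsFiniteMeasure α] {n : ℕ}
    (z : Fin n → ℝ) : IsFiniteMeasure (posteriorBase α z) := by
  unfold posteriorBase; infer_instance

lemma posteriorBase_ne_zero {α : Measure ℝ} (hα : α ≠ 0) {n : ℕ} (z : Fin n → ℝ) :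
    posteriorBase α z ≠ 0 := by
  intro h
  refine hα (Measure.measure_univ_eq_zero.1 ?_)
  have h1 : posteriorBase α z Set.univ = 0 := by rw [h]; simp
  rw [posteriorBase, Measure.add_apply] at h1
  exact (add_eq_zero.1 h1).1

lemma integrable_posteriorBase {α : Measure ℝ} {f : ℝ → ℝ} (hfi : Integrable f α) {n : ℕ}
    (z : Fin n → ℝ) : Integrable f (posteriorBase α z) :=
  hfi.add_measure (integrable_finsetSum_measure.2 fun i _ => integrable_dirac (by simp))

lemma posteriorBase_apply (α : Measure ℝ) [IsFiniteMeasure α] {n : ℕ} (z : Fin n → ℝ) {A : Set ℝ}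
    (hA : MeasurableSet A) [DecidablePred fun i => z i ∈ A] :
    (posteriorBase α z A).toNNReal =
      (α A).toNNReal + ((Finset.univ.filter fun i => z i ∈ A).card : ℝ≥0) := by
  rw [posteriorBase, Measure.add_apply, ENNReal.toNNReal_add (measure_ne_top _ _)
    (measure_ne_top _ _), Measure.finsetSum_apply]
  congr 1
  simp_rw [Measure.dirac_apply' _ hA, Set.indicator_apply, Pi.one_apply]
  rw [Finset.sum_ite, Finset.sum_const_zero, add_zero, Finset.sum_const, nsmul_one,
    ENNReal.toNNReal_natCast]

lemma inv_posteriorBase_univ_le (α : Measure ℝ) {n : ℕ} (hn : 0 < n) (z : Fin n → ℝ) :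
    (posteriorBase α z Set.univ)⁻¹ ≤ 1 := by
  rw [ENNReal.inv_le_one, posteriorBase, Measure.add_apply, Measure.finsetSum_apply]
  simp only [measure_univ, Finset.sum_const, Finset.card_univ, Fintype.card_fin, nsmul_one]
  exact le_add_left (by exact_mod_cast hn)

/-- For a finitely valued function, the posterior law of the rescaled functional is a linear
functional of a Dirichlet vector. -/
lemma map_integral_eq_map_dirichletLaw {α : Measure ℝ} [IsFiniteMeasure α] {n : ℕ}
    {z : Fin n → ℝ} {Q : Measure (ProbabilityMeasure ℝ)}
    (hQ : IsDirichletProcess (posteriorBase α z) Q) {k : ℕ} {y : Fin k → ℝ} {h : ℝ → ℝ}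
    (hy : Function.Injective y) (hh : Measurable h) (hhy : ∀ x, ∃ j, h x = y j) {c : Fin n → Fin k}
    (hc : ∀ i, h (z i) = y (c i)) (v r : ℝ) :
    Q.map (fun G : ProbabilityMeasure ℝ => n / r * (∫ s, h s ∂(G : Measure ℝ) - v)) =
      (dirichletLaw fun j => (α (h ⁻¹' {y j})).toNNReal +
        ((Finset.univ.filter fun i => c i = j).card : ℝ≥0)).map
          fun w => n * ∑ j, (y j - v) / r * w j := by
  classical
  have hA : ∀ j, MeasurableSet (h ⁻¹' {y j}) := fun j => hh (measurableSet_singleton _)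
  have hmap := hQ.map_partition k (fun j => h ⁻¹' {y j}) hA (by
    intro i j hij
    refine Set.disjoint_left.2 fun x hx hx' => hij (hy ?_)
    simp only [Set.mem_preimage, Set.mem_singleton_iff] at hx hx'
    rw [← hx, ← hx']) (by
    refine Set.eq_univ_of_forall fun x => ?_
    obtain ⟨j, hj⟩ := hhy x
    exact Set.mem_iUnion.2 ⟨j, by simpa using hj⟩)
  have hpar : (fun j => (posteriorBase α z (h ⁻¹' {y j})).toNNReal) = fun j =>
      (α (h ⁻¹' {y j})).toNNReal + ((Finset.univ.filter fun i => c i = j).card : ℝ≥0) := by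
    funext j
    rw [posteriorBase_apply α z (hA j)]
    congr 3
    ext i
    simp only [Finset.mem_filter, Finset.mem_univ, true_and, Set.mem_preimage,
      Set.mem_singleton_iff, hc]
    exact hy.eq_iff
  rw [hpar] at hmap
  rw [← hmap, Measure.map_map (by fun_prop)
    (measurable_pi_lambda _ fun i => measurable_measureReal_coe (hA i))]
  congr 1
  funext G
  have h1 := (integral_comp_eq_sum_of_finite_values (G : Measure ℝ) hh hy hhy fun t => t).2
  have h2 := (integral_comp_eq_sum_of_finite_values (G : Measure ℝ) hh hy hhy fun _ => 1).2
  simp only [integral_const, probReal_univ, one_smul, one_mul] at h2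
  simp only [Function.comp_apply]
  have h3 : ∫ s, h s ∂(G : Measure ℝ) - v =
      ∑ j, (y j - v) * (G : Measure ℝ).real (h ⁻¹' {y j}) := by
    simp_rw [sub_mul]
    rw [Finset.sum_sub_distrib, ← h1, ← Finset.mul_sum, ← h2, mul_one]
  rw [h3, div_mul_eq_mul_div, mul_div_assoc, Finset.sum_div]
  congr 1
  exact Finset.sum_congr rfl fun j _ => by ring

/-- As the weights sum to zero, the exponential factors cancel; the rest is grouped by cell. -/
lemma prod_exp_div_eq_prod_fiber {n k : ℕ} (c : Fin n → Fin k) (b : Fin k → ℝ)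
    (hb : ∑ i, b (c i) = 0) (t : ℝ) :
    ∏ i, Complex.exp (-((t * b (c i) : ℝ) * Complex.I)) / (1 - (t * b (c i) : ℝ) * Complex.I) =
      ∏ j, ((1 - (t * b j : ℝ) * Complex.I) ^ (Finset.univ.filter fun i => c i = j).card)⁻¹ := by
  rw [Finset.prod_div_distrib, ← Complex.exp_sum]
  have h1 : ∑ i, -(((t * b (c i) : ℝ) : ℂ) * Complex.I) = 0 := by
    rw [Finset.sum_neg_distrib, ← Finset.sum_mul, ← Complex.ofReal_sum, ← Finset.mul_sum, hb]
    simp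
  rw [h1, Complex.exp_zero, one_div, ← Finset.prod_inv_distrib,
    ← Finset.prod_fiberwise Finset.univ c, Finset.prod_inv_distrib]
  simp_rw [Finset.prod_inv_distrib]
  congr 1
  refine Finset.prod_congr rfl fun j _ => ?_
  rw [Finset.prod_congr rfl (g := fun _ => 1 - ((t * b j : ℝ) : ℂ) * Complex.I), Finset.prod_const]
  intro i hi
  rw [(Finset.mem_filter.1 hi).2]

lemma sum_mul_card_fiber {n k : ℕ} (c : Fin n → Fin k) (a : Fin k → ℝ) :
    ∑ j, a j * ((Finset.univ.filter fun i => c i = j).card : ℝ) = ∑ i, a (c i) := by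
  rw [← Finset.sum_fiberwise Finset.univ c]
  refine Finset.sum_congr rfl fun j _ => ?_
  rw [Finset.sum_congr rfl (g := fun _ => a j), Finset.sum_const, nsmul_eq_mul, mul_comm]
  intro i hi
  rw [(Finset.mem_filter.1 hi).2]

lemma integral_abs_sub_const_le {α : Measure ℝ} [IsFiniteMeasure α] {f h : ℝ → ℝ}
    (hf : Integrable f α) (hh : Integrable h α) (v : ℝ) :
    ∫ s, |h s - v| ∂α ≤ ∫ s, |f s - h s| ∂α + ∫ s, |f s| ∂α + |v| * α.real Set.univ := by
  have i1 : Integrable (fun s => |f s - h s|) α := (hf.sub hh).abs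
  have i2 : Integrable (fun s => |f s - h s| + |f s|) α := i1.add hf.abs
  calc ∫ s, |h s - v| ∂α ≤ ∫ s, (|f s - h s| + |f s| + |v|) ∂α := by
        refine integral_mono (hh.sub (integrable_const _)).abs (i2.add (integrable_const _))
          fun s => ?_
        have e1 := abs_sub (h s) v
        have e2 := abs_sub_abs_le_abs_sub (h s) (f s)
        rw [abs_sub_comm] at e2
        change |h s - v| ≤ |f s - h s| + |f s| + |v|
        linarith
    _ = _ := by
        rw [integral_add i2 (integrable_const _), integral_add i1 hf.abs, integral_const,
          smul_eq_mul, mul_comm |v|]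

/-- Given the sample, the rescaled posterior law of `G ↦ ∫ f dG` is close to a law with the
characteristic function of a linear combination of centered exponential variables, with weights
`(f (z i) - v) / r`. -/
theorem exists_boundedLipschitzDist_posterior_le {α : Measure ℝ} [IsFiniteMeasure α] (hα : α ≠ 0)
    {f : ℝ → ℝ} (hf : Measurable f) (hfi : Integrable f α) {n : ℕ} (hn : 3 ≤ n) (z : Fin n → ℝ)
    {Q : Measure (ProbabilityMeasure ℝ)} (hQ : IsDirichletProcess (posteriorBase α z) Q)
    {v r κ η : ℝ} (hv : v = (∑ i, f (z i)) / n) (hr : 0 < r) (hκ : 0 < κ) (hη : 0 < η) :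
    ∃ μ : Measure ℝ, IsProbabilityMeasure μ ∧
      (∀ t : ℝ, charFun μ t = ∏ i, Complex.exp (-((t * ((f (z i) - v) / r) : ℝ) * Complex.I)) /
        (1 - (t * ((f (z i) - v) / r) : ℝ) * Complex.I)) ∧
      ∫⁻ x, ENNReal.ofReal (x ^ 2) ∂μ ≤ ENNReal.ofReal (∑ i, ((f (z i) - v) / r) ^ 2) ∧
      boundedLipschitzDist
        (Q.map fun G : ProbabilityMeasure ℝ => n / r * (∫ s, f s ∂(G : Measure ℝ) - v)) μ ≤
        ENNReal.ofReal (κ * ∑ i, ((f (z i) - v) / r) ^ 2 +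
          κ⁻¹ * (((2 - α.real Set.univ) ^ 2 + 1) / (n - 2)) +
          2 * ((∫ s, |f s| ∂α + |v| * α.real Set.univ) / r) + η) := by
  have hnR : (3 : ℝ) ≤ n := by exact_mod_cast hn
  have := hQ.isProbabilityMeasure
  -- the approximation enters the bound through `n / r * η'` and `2 * (η' / r)`, together `η`
  set η' : ℝ := η * r / (n + 2) with hη'
  have hη'0 : 0 < η' := by positivity
  obtain ⟨k, y, h, hy, hh, hhy, hhz, happ⟩ := exists_finite_valued_approx hf
    (integrable_posteriorBase hfi z) z hη'0
  choose c hc using fun i => hhy (z i)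
  set m : Fin k → ℕ := fun j => (Finset.univ.filter fun i => c i = j).card with hm
  set p : Fin k → ℝ≥0 := fun j => (α (h ⁻¹' {y j})).toNNReal with hp
  set b : Fin k → ℝ := fun j => (y j - v) / r with hb
  have hbc : ∀ i, b (c i) = (f (z i) - v) / r := fun i => by rw [hb, ← hhz i, hc i]
  have hsum0 : ∑ i, b (c i) = 0 := by
    simp_rw [hbc]
    rw [← Finset.sum_div, Finset.sum_sub_distrib, hv]
    simp only [Finset.sum_const, Finset.card_univ, Fintype.card_fin, nsmul_eq_mul]
    rw [mul_div_cancel₀ _ (by linarith : (n : ℝ) ≠ 0), sub_self, zero_div]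
  have hint := fun φ : ℝ → ℝ => integral_comp_eq_sum_of_finite_values α hh hy hhy φ
  have hpreal : ∀ j, (p j : ℝ) = α.real (h ⁻¹' {y j}) := fun j => rfl
  have hpsum : ∑ j, (p j : ℝ) = α.real Set.univ := by
    have := (hint fun _ => 1).2
    simp only [integral_const, smul_eq_mul, mul_one, one_mul] at this
    exact this.symm
  have hmsum : ∑ j, m j = n := by
    rw [hm, ← Finset.card_eq_sum_card_fiberwise (by simp), Finset.card_univ, Fintype.card_fin]
  refine ⟨(Measure.pi fun j => gammaLaw (m j)).map fun w => ∑ j, b j * w j,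
    Measure.isProbabilityMeasure_map (Measurable.aemeasurable (by fun_prop)), fun t => ?_, ?_, ?_⟩
  · rw [charFun_map_weighted_sum_gammaLaw, ← prod_exp_div_eq_prod_fiber c b hsum0]
    simp_rw [hbc]
  · rw [lintegral_map (by fun_prop) (by fun_prop), lintegral_weighted_sum_gammaLaw_sq]
    · simp only [NNReal.coe_natCast]
      rw [sum_mul_card_fiber c fun j => b j ^ 2]
      simp_rw [hbc]
      exact le_rfl
    · simp only [NNReal.coe_natCast]
      rw [sum_mul_card_fiber c b, hsum0]
  · have hcore := boundedLipschitzDist_dirichletLaw_le p (fun j => (m j : ℝ≥0)) hn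
      (by rw [← Nat.cast_sum, hmsum]) b
      (by simp only [NNReal.coe_natCast]; rw [sum_mul_card_fiber c b, hsum0]) hκ
    rw [← map_integral_eq_map_dirichletLaw hQ hy hh hhy hc v r] at hcore
    refine (boundedLipschitzDist_triangle _ _ _).trans ((add_le_add
      (b := ENNReal.ofReal (n / r * η')) ?_ hcore).trans ?_)
    · refine (boundedLipschitzDist_map_le Q
        (((measurable_integral_coe hf).sub_const _).const_mul _).aemeasurable
        (((measurable_integral_coe hh).sub_const _).const_mul _).aemeasurable).trans ?_
      have hai := hQ.ae_integrable (posteriorBase_ne_zero hα z) hf (integrable_posteriorBase hfi z)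
      calc _ ≤ ∫⁻ G : ProbabilityMeasure ℝ, ENNReal.ofReal (n / r) *
            ∫⁻ s, ‖f s - h s‖ₑ ∂(G : Measure ℝ) ∂Q := by
            refine lintegral_mono_ae ?_
            filter_upwards [hai] with G hG
            have hhG := (integral_comp_eq_sum_of_finite_values (G : Measure ℝ) hh hy hhy
              fun t => t).1
            rw [← mul_sub, sub_sub_sub_cancel_right, abs_mul, abs_of_pos (by positivity),
              ENNReal.ofReal_mul (by positivity), ← integral_sub hG hhG, ← Real.enorm_eq_ofReal_abs]
            gcongr
            exact enorm_integral_le_lintegral_enorm _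
        _ = ENNReal.ofReal (n / r) * ((posteriorBase α z Set.univ)⁻¹ *
              ∫⁻ s, ‖f s - h s‖ₑ ∂posteriorBase α z) := by
            rw [lintegral_const_mul _ (measurable_lintegral_coe (by fun_prop)),
              hQ.lintegral_lintegral (posteriorBase_ne_zero hα z) (by fun_prop)]
        _ ≤ ENNReal.ofReal (n / r) * (1 * ENNReal.ofReal η') := by
            gcongr
            exact inv_posteriorBase_univ_le α (by omega) z
        _ = _ := by rw [one_mul, ENNReal.ofReal_mul (by positivity)]
    · have hhα : Integrable h α := (hint fun t => t).1
      have hb1 : ∑ j, |b j| * (p j : ℝ) = (∫ s, |h s - v| ∂α) / r := by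
        rw [(hint fun t => |t - v|).2, Finset.sum_div]
        refine Finset.sum_congr rfl fun j _ => ?_
        rw [hb, abs_div, abs_of_pos hr, hpreal]
        ring
      have hfh : ∫ s, |f s - h s| ∂α ≤ η' := by
        rw [integral_eq_lintegral_of_nonneg_ae (ae_of_all _ fun _ => abs_nonneg _)
          (Measurable.aestronglyMeasurable (by fun_prop))]
        refine ENNReal.toReal_le_of_le_ofReal hη'0.le ((le_of_eq ?_).trans
          ((lintegral_mono' (Measure.le_add_right le_rfl) le_rfl).trans happ))
        simp_rw [Real.enorm_eq_ofReal_abs]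
      have hb2 : ∫ s, |h s - v| ∂α ≤ ∫ s, |f s| ∂α + |v| * α.real Set.univ + η' := by
        have := integral_abs_sub_const_le hfi hhα v
        linarith
      have hs1 : 0 ≤ κ * ∑ j, b j ^ 2 * ((m j : ℝ≥0) : ℝ) +
          κ⁻¹ * (((2 - ∑ j, (p j : ℝ)) ^ 2 + 1) / (n - 2)) + 2 * ∑ j, |b j| * (p j : ℝ) := by
        have h1 : 0 ≤ ∑ j, b j ^ 2 * ((m j : ℝ≥0) : ℝ) :=
          Finset.sum_nonneg fun j _ => by positivity
        have h2 : 0 ≤ ∑ j, |b j| * (p j : ℝ) := Finset.sum_nonneg fun j _ => by positivity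
        have h3 : 0 ≤ ((2 - ∑ j, (p j : ℝ)) ^ 2 + 1) / ((n : ℝ) - 2) :=
          div_nonneg (by positivity) (by linarith)
        exact add_nonneg (add_nonneg (mul_nonneg hκ.le h1) (mul_nonneg (inv_nonneg.2 hκ.le) h3))
          (mul_nonneg zero_le_two h2)
      rw [← ENNReal.ofReal_add (by positivity) hs1]
      refine ENNReal.ofReal_le_ofReal ?_
      simp only [NNReal.coe_natCast]
      rw [sum_mul_card_fiber c fun j => b j ^ 2, hpsum, hb1]
      simp_rw [hbc]
      have hfin : n / r * η' + 2 * (η' / r) = η := by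
        rw [hη']; field_simp
      have hb3 : (∫ s, |h s - v| ∂α) / r ≤
          (∫ s, |f s| ∂α + |v| * α.real Set.univ) / r + η' / r := by
        rw [← add_div]
        gcongr
      linarith

/-! ### A weak law of large numbers for tails of exact order one -/

/-- A tail function `H` with `s H(s) → g` has integral `g log B + o(log B)` over `[0, B]`. -/
lemma tendsto_integral_tail_div_log {H : ℝ → ℝ} (hH : Antitone H) (h0 : ∀ s, 0 ≤ H s)
    (h1 : ∀ s, H s ≤ 1) {g : ℝ} (hg : Tendsto (fun s => s * H s) atTop (𝓝 g)) :
    Tendsto (fun B => (∫ s in 0..B, H s) / Real.log B) atTop (𝓝 g) := by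
  have hint : ∀ a b, IntervalIntegrable H volume a b := fun a b =>
    (hH.antitoneOn _).intervalIntegrable
  rw [Metric.tendsto_atTop'] at hg
  rw [Metric.tendsto_nhds]
  intro ε hε
  obtain ⟨S₀, hS₀⟩ := hg (ε / 2) (half_pos hε)
  set S := max S₀ 0 + 1 with hS
  have hS1 : 1 ≤ S := by rw [hS]; linarith [le_max_right S₀ 0]
  have hSpos : 0 < S := by linarith
  have hS' : ∀ s, S ≤ s → |s * H s - g| ≤ ε / 2 := fun s hs => by
    have := hS₀ s (by rw [hS] at hs; linarith [le_max_left S₀ 0])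
    rw [Real.dist_eq] at this
    exact this.le
  have hlog : Tendsto Real.log atTop atTop := Real.tendsto_log_atTop
  have hev := hlog.eventually_gt_atTop ((S + (|g| + ε / 2) * Real.log S) / (ε / 2))
  filter_upwards [hev, eventually_gt_atTop S] with B hB hBS
  have hBpos : 0 < B := hSpos.trans hBS
  have hlogB : 0 < Real.log B := Real.log_pos (by linarith)
  have hlogS : 0 ≤ Real.log S := Real.log_nonneg hS1
  have hIS : |∫ s in 0..S, H s| ≤ S := by
    have := intervalIntegral.norm_integral_le_of_norm_le_const (a := 0) (b := S) (f := H) (C := 1)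
      fun s _ => by rw [Real.norm_eq_abs, abs_of_nonneg (h0 s)]; exact h1 s
    rwa [Real.norm_eq_abs, sub_zero, one_mul, abs_of_pos hSpos] at this
  have hinv : IntervalIntegrable (fun s : ℝ => s⁻¹) volume S B := by
    refine (intervalIntegral.intervalIntegrable_inv (fun s hs => ?_) continuousOn_id)
    rw [Set.uIcc_of_le hBS.le] at hs
    exact (hSpos.trans_le hs.1).ne'
  have hlogdiv : Real.log (B / S) = Real.log B - Real.log S :=
    Real.log_div hBpos.ne' hSpos.ne'
  have hIB : |(∫ s in S..B, H s) - g * Real.log (B / S)| ≤ ε / 2 * Real.log (B / S) := by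
    rw [← integral_inv_of_pos hSpos hBpos, ← intervalIntegral.integral_const_mul,
      ← intervalIntegral.integral_const_mul, ← intervalIntegral.integral_sub (hint _ _)
      (hinv.const_mul g)]
    refine (intervalIntegral.abs_integral_le_integral_abs hBS.le).trans ?_
    refine intervalIntegral.integral_mono_on hBS.le ((hint _ _).sub (hinv.const_mul g)).abs
      (hinv.const_mul _) fun s hs => ?_
    have hs0 : 0 < s := hSpos.trans_le hs.1
    have e : H s - g * s⁻¹ = (s * H s - g) * s⁻¹ := by field_simp
    rw [e, abs_mul, abs_of_pos (inv_pos.2 hs0)]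
    exact mul_le_mul_of_nonneg_right (hS' s hs.1) (inv_nonneg.2 hs0.le)
  rw [Real.dist_eq, div_sub' hlogB.ne', abs_div, abs_of_pos hlogB, div_lt_iff₀ hlogB,
    ← intervalIntegral.integral_add_adjacent_intervals (hint 0 S) (hint S B)]
  rw [hlogdiv] at hIB
  rw [div_lt_iff₀ (half_pos hε)] at hB
  have hgS : |g * Real.log S| = |g| * Real.log S := by rw [abs_mul, abs_of_nonneg hlogS]
  have a1 := abs_le.1 hIS
  have a2 := abs_le.1 hIB
  have a3 := abs_le.1 hgS.le
  have a4 : 0 ≤ ε / 2 * Real.log S := by positivity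
  rw [abs_lt]
  constructor <;> nlinarith [a1.1, a1.2, a2.1, a2.2, a3.1, a3.2]

lemma tendsto_natCast_mul_log_atTop :
    Tendsto (fun n : ℕ => (n : ℝ) * Real.log n) atTop atTop :=
  tendsto_natCast_atTop_atTop.atTop_mul_atTop₀
    (Real.tendsto_log_atTop.comp tendsto_natCast_atTop_atTop)

lemma tendsto_log_natCast_atTop : Tendsto (fun n : ℕ => Real.log n) atTop atTop :=
  Real.tendsto_log_atTop.comp tendsto_natCast_atTop_atTop

lemma tendsto_log_mul_log_div_log :
    Tendsto (fun n : ℕ => Real.log (n * Real.log n) / Real.log n) atTop (𝓝 1) := by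
  have h1 : Tendsto (fun n : ℕ => 1 + Real.log (Real.log n) / Real.log n) atTop (𝓝 (1 + 0)) :=
    tendsto_const_nhds.add
      ((Real.isLittleO_log_id_atTop.tendsto_div_nhds_zero).comp tendsto_log_natCast_atTop)
  rw [add_zero] at h1
  refine h1.congr' ?_
  filter_upwards [tendsto_log_natCast_atTop.eventually_gt_atTop 0, eventually_gt_atTop 0]
    with n hn hn0
  have : (n : ℝ) ≠ 0 := by exact_mod_cast hn0.ne'
  rw [Real.log_mul this hn.ne', add_div, div_self hn.ne']

section WeakLaw

variable {Ω : Type*} [MeasurableSpace Ω] {P : Measure Ω} [IsProbabilityMeasure P]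

lemma integral_min_eq {X : Ω → ℝ} (hX : AEMeasurable X P) (hX0 : ∀ ω, 0 ≤ X ω) {H : ℝ → ℝ}
    (htail : ∀ s, 0 < s → P.real {ω | s < X ω} = H s) {B : ℝ} (hB : 0 < B) :
    ∫ ω, min (X ω) B ∂P = ∫ s in 0..B, H s := by
  have hint : Integrable (fun ω => min (X ω) B) P := by
    refine Integrable.of_bound (hX.min aemeasurable_const).aestronglyMeasurable B
      (ae_of_all _ fun ω => ?_)
    rw [Real.norm_eq_abs, abs_of_nonneg (le_min (hX0 ω) hB.le)]
    exact min_le_right _ _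
  rw [hint.integral_eq_integral_meas_lt (ae_of_all _ fun ω => le_min (hX0 ω) hB.le),
    intervalIntegral.integral_of_le hB.le, integral_Ioc_eq_integral_Ioo,
    ← Set.Ioi_inter_Iio, ← setIntegral_indicator measurableSet_Iio]
  refine setIntegral_congr_fun measurableSet_Ioi fun s hs => ?_
  by_cases hsB : s < B
  · rw [Set.indicator_of_mem (Set.mem_Iio.2 hsB), ← htail s hs]
    simp [hsB]
  · rw [Set.indicator_of_notMem (by simpa using hsB)]
    simp [hsB]

lemma integral_min_sq_le {X : Ω → ℝ} (hX : AEMeasurable X P) (hX0 : ∀ ω, 0 ≤ X ω) {C : ℝ}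
    (hC : 0 ≤ C) (htail : ∀ s, 0 < s → s * P.real {ω | s < X ω} ≤ C) {B : ℝ} (hB : 0 < B) :
    ∫ ω, (min (X ω) B) ^ 2 ∂P ≤ 2 * C * B := by
  have hm : AEMeasurable (fun ω => min (X ω) B) P := hX.min aemeasurable_const
  rw [integral_eq_lintegral_of_nonneg_ae (ae_of_all _ fun ω => sq_nonneg _)
    (hm.pow_const 2).aestronglyMeasurable]
  refine ENNReal.toReal_le_of_le_ofReal (by positivity) ?_
  have h := lintegral_rpow_eq_lintegral_meas_lt_mul P
    (ae_of_all _ fun ω => le_min (hX0 ω) hB.le) hm (p := 2) two_pos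
  simp only [Real.rpow_two] at h
  rw [h]
  calc _ ≤ ENNReal.ofReal 2 * ∫⁻ t in Set.Ioi 0, (Set.Ioo 0 B).indicator
        (fun _ => ENNReal.ofReal C) t := by
        gcongr ENNReal.ofReal 2 * ?_
        refine setLIntegral_mono' measurableSet_Ioi fun s hs => ?_
        have hs0 : 0 < s := hs
        by_cases hsB : s < B
        · rw [Set.indicator_of_mem (show s ∈ Set.Ioo 0 B from ⟨hs, hsB⟩)]
          have e : {ω | s < min (X ω) B} = {ω | s < X ω} := by simp [hsB]
          rw [e, ← ofReal_measureReal, ← ENNReal.ofReal_mul measureReal_nonneg]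
          refine ENNReal.ofReal_le_ofReal ?_
          norm_num
          linarith [htail s hs0]
        · have e : {ω | s < min (X ω) B} = ∅ := by simp [hsB]
          rw [e]; simp
    _ = ENNReal.ofReal (2 * C * B) := by
        rw [lintegral_indicator_const measurableSet_Ioo, Measure.restrict_apply measurableSet_Ioo,
          Set.inter_eq_left.2 Set.Ioo_subset_Ioi_self, Real.volume_Ioo, sub_zero, mul_assoc,
          ENNReal.ofReal_mul zero_le_two, ENNReal.ofReal_mul hC]

lemma measure_exists_lt_le {X : ℕ → Ω → ℝ} {C : ℝ}
    (htail : ∀ i s, 0 < s → s * P.real {ω | s < X i ω} ≤ C) (n : ℕ) {s : ℝ} (hs : 0 < s) :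
    P {ω | ∃ i : Fin n, s < X i ω} ≤ ENNReal.ofReal (n * (C / s)) := by
  have h1 : ∀ i, P {ω | s < X i ω} ≤ ENNReal.ofReal (C / s) := fun i => by
    rw [← ofReal_measureReal]
    refine ENNReal.ofReal_le_ofReal ?_
    rw [le_div_iff₀ hs, mul_comm]
    exact htail i s hs
  rw [Set.ofPred_exists]
  refine (measure_iUnion_fintype_le P _).trans
    ((Finset.sum_le_sum fun (i : Fin n) _ => h1 i).trans ?_)
  rw [Finset.sum_const, Finset.card_univ, Fintype.card_fin, nsmul_eq_mul,
    ENNReal.ofReal_mul n.cast_nonneg, ENNReal.ofReal_natCast]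

/-- The largest of `n` variables with tails of order one is `o(n log n)`. -/
lemma tendsto_measure_exists_lt {X : ℕ → Ω → ℝ} {C : ℝ}
    (htail : ∀ i s, 0 < s → s * P.real {ω | s < X i ω} ≤ C) {δ : ℝ} (hδ : 0 < δ) :
    Tendsto (fun n : ℕ => P {ω | ∃ i : Fin n, δ * (n * Real.log n) < X i ω}) atTop (𝓝 0) := by
  have hlim : Tendsto (fun n : ℕ => ENNReal.ofReal (C / δ / Real.log n)) atTop (𝓝 0) := by
    have := tendsto_log_natCast_atTop.const_div_atTop (C / δ)
    exact (ENNReal.continuous_ofReal.tendsto' 0 0 ENNReal.ofReal_zero).comp this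
  refine tendsto_of_tendsto_of_tendsto_of_le_of_le' tendsto_const_nhds hlim
    (Eventually.of_forall fun _ => zero_le) ?_
  filter_upwards [tendsto_log_natCast_atTop.eventually_gt_atTop 0, eventually_gt_atTop 0]
    with n hn hn0
  have hnR : (0 : ℝ) < n := by exact_mod_cast hn0
  refine (measure_exists_lt_le htail n (by positivity)).trans (le_of_eq ?_)
  congr 1
  field_simp

/-- **Weak law** for independent nonnegative variables whose tail is asymptotic to `g / s`: their
sum is `g n log n` to first order. As the mean is infinite, the variables are truncated at
`n log n`, which changes none of them with probability tending to one. -/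
theorem tendsto_measure_sum_div_log {X : ℕ → Ω → ℝ} (hX : ∀ i, AEMeasurable (X i) P)
    (hX0 : ∀ i ω, 0 ≤ X i ω) (hindep : iIndepFun X P) {H : ℝ → ℝ} (hH : Antitone H)
    (hH0 : ∀ s, 0 ≤ H s) (hH1 : ∀ s, H s ≤ 1)
    (htail : ∀ i s, 0 < s → P.real {ω | s < X i ω} = H s) {C g : ℝ} (hC : 0 ≤ C)
    (hHC : ∀ s, 0 < s → s * H s ≤ C) (hg : Tendsto (fun s => s * H s) atTop (𝓝 g))
    {ε : ℝ} (hε : 0 < ε) :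
    Tendsto (fun n : ℕ => P {ω | ε ≤ |(∑ i : Fin n, X i ω) / (n * Real.log n) - g|})
      atTop (𝓝 0) := by
  have htail' : ∀ i s, 0 < s → s * P.real {ω | s < X i ω} ≤ C := fun i s hs => by
    rw [htail i s hs]; exact hHC s hs
  have hM : Tendsto (fun n : ℕ => (∫ s in 0..(n * Real.log n), H s) / Real.log n) atTop (𝓝 g) := by
    have h1 := ((tendsto_integral_tail_div_log hH hH0 hH1 hg).comp
      tendsto_natCast_mul_log_atTop).mul tendsto_log_mul_log_div_log
    rw [mul_one] at h1
    refine h1.congr' ?_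
    filter_upwards [tendsto_natCast_mul_log_atTop.eventually_gt_atTop 1] with n hn
    have : Real.log (n * Real.log n) ≠ 0 := (Real.log_pos hn).ne'
    simp only [Function.comp_apply]
    field_simp
  have hlim2 : Tendsto (fun n : ℕ => ENNReal.ofReal (8 * C / ε ^ 2 / Real.log n)) atTop
      (𝓝 0) := by
    have := tendsto_log_natCast_atTop.const_div_atTop (8 * C / ε ^ 2)
    exact (ENNReal.continuous_ofReal.tendsto' 0 0 ENNReal.ofReal_zero).comp this
  have hlim := (tendsto_measure_exists_lt htail' one_pos).add hlim2
  rw [add_zero] at hlim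
  refine tendsto_of_tendsto_of_tendsto_of_le_of_le' tendsto_const_nhds hlim
    (Eventually.of_forall fun _ => zero_le) ?_
  filter_upwards [tendsto_log_natCast_atTop.eventually_gt_atTop 0, eventually_gt_atTop 0,
    (Metric.tendsto_nhds.1 hM) (ε / 2) (half_pos hε)] with n hlog hn0 hMn
  have hnR : (0 : ℝ) < n := by exact_mod_cast hn0
  set B : ℝ := n * Real.log n with hB
  have hBpos : 0 < B := by positivity
  set M : ℝ := ∫ s in 0..B, H s with hMdef
  set T : ℕ → Ω → ℝ := fun i ω => min (X i ω) B with hT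
  have hTm : ∀ i, AEMeasurable (T i) P := fun i => (hX i).min aemeasurable_const
  have hTL : ∀ i, MemLp (T i) 2 P := fun i =>
    memLp_of_bounded (a := 0) (b := B) (ae_of_all _ fun ω => ⟨le_min (hX0 i ω) hBpos.le,
      min_le_right _ _⟩) (hTm i).aestronglyMeasurable 2
  have hTindep : iIndepFun T P := hindep.comp (fun _ t => min t B) fun _ => by fun_prop
  have hTmean : ∀ i, ∫ ω, T i ω ∂P = M := fun i =>
    integral_min_eq (hX i) (hX0 i) (htail i) hBpos
  have hTvar : ∀ i, Var[T i; P] ≤ 2 * C * B := fun i =>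
    (variance_le_expectation_sq (hTm i).aestronglyMeasurable).trans
      (integral_min_sq_le (hX i) (hX0 i) hC (htail' i) hBpos)
  set Sn : Ω → ℝ := ∑ i : Fin n, T i with hSn
  have hSnL : MemLp Sn 2 P := memLp_finsetSum' _ fun i _ => hTL i
  have hSnvar : Var[Sn; P] ≤ n * (2 * C * B) := by
    rw [hSn, IndepFun.variance_sum (X := fun (i : Fin n) => T i) (fun i _ => hTL i) fun i _ j _ hij =>
      hTindep.indepFun (fun h => hij (Fin.ext h))]
    refine (Finset.sum_le_sum fun (i : Fin n) _ => hTvar i).trans (le_of_eq ?_)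
    simp
  have hSnmean : ∫ ω, Sn ω ∂P = n * M := by
    simp only [hSn, Finset.sum_apply]
    rw [integral_finsetSum (f := fun (i : Fin n) ω => T i ω) _
      fun i _ => (hTL i).integrable (by norm_num)]
    simp [hTmean]
  have hcheb := meas_ge_le_variance_div_sq hSnL (c := ε / 2 * B) (by positivity)
  refine (measure_mono (t := {ω | ∃ i : Fin n, 1 * B < X i ω} ∪
    {ω | ε / 2 * B ≤ |Sn ω - ∫ ω, Sn ω ∂P|}) ?_).trans ((measure_union_le _ _).trans ?_)
  · intro ω hω
    simp only [Set.mem_union, Set.mem_ofPred_eq]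
    by_contra! hcon
    obtain ⟨h1, h2⟩ := hcon
    have hSneq : Sn ω = ∑ i : Fin n, X i ω := by
      simp only [hSn, Finset.sum_apply, hT]
      exact Finset.sum_congr rfl fun i _ => min_eq_left (by simpa using h1 i)
    rw [hSneq, hSnmean] at h2
    simp only [Set.mem_ofPred_eq] at hω
    rw [Real.dist_eq] at hMn
    have e : (∑ i : Fin n, X i ω) / B - g =
        ((∑ i : Fin n, X i ω) - n * M) / B + (M / Real.log n - g) := by
      rw [hB]; field_simp; ring
    have h3 : |((∑ i : Fin n, X i ω) - n * M) / B| < ε / 2 := by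
      rwa [abs_div, abs_of_pos hBpos, div_lt_iff₀ hBpos]
    have h4 := abs_add_le (((∑ i : Fin n, X i ω) - n * M) / B) (M / Real.log n - g)
    rw [← e] at h4
    linarith
  · gcongr
    refine hcheb.trans (ENNReal.ofReal_le_ofReal ?_)
    calc Var[Sn; P] / (ε / 2 * B) ^ 2 ≤ n * (2 * C * B) / (ε / 2 * B) ^ 2 := by gcongr
      _ = 8 * C / ε ^ 2 / Real.log n := by
        rw [hB]; field_simp; ring

lemma lintegral_sqrt_le {X : Ω → ℝ} (hX : AEMeasurable X P) {C : ℝ}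
    (hC : 0 ≤ C) (htail : ∀ s, 0 < s → s * P.real {ω | s < X ω} ≤ C) :
    ∫⁻ ω, ENNReal.ofReal √(X ω) ∂P ≤ ENNReal.ofReal (1 + C) := by
  rw [lintegral_eq_lintegral_meas_lt P (ae_of_all _ fun ω => Real.sqrt_nonneg _)
    (Real.continuous_sqrt.measurable.comp_aemeasurable hX),
    ← Set.Ioc_union_Ioi_eq_Ioi zero_le_one, lintegral_union measurableSet_Ioi
      (Set.Ioc_disjoint_Ioi le_rfl), ENNReal.ofReal_add zero_le_one hC]
  refine add_le_add ?_ ?_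
  · refine (setLIntegral_mono' (g := fun _ => 1) measurableSet_Ioc fun t _ => prob_le_one).trans ?_
    simp
  · calc _ ≤ ∫⁻ t in Set.Ioi (1 : ℝ), ENNReal.ofReal (C * t ^ (-2 : ℝ)) := by
          refine setLIntegral_mono' measurableSet_Ioi fun t ht => ?_
          have ht0 : 0 < t := one_pos.trans ht
          have e : {ω | t < √(X ω)} = {ω | t ^ 2 < X ω} := by
            ext ω
            exact Real.lt_sqrt ht0.le
          rw [e, ← ofReal_measureReal]
          refine ENNReal.ofReal_le_ofReal ?_
          rw [Real.rpow_neg ht0.le, Real.rpow_two, ← div_eq_mul_inv, le_div_iff₀ (by positivity),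
            mul_comm]
          exact htail _ (by positivity)
      _ = ENNReal.ofReal C := by
          have hi := integrableOn_Ioi_rpow_of_lt (a := -2) (by norm_num) one_pos
          rw [← ofReal_integral_eq_lintegral_ofReal (hi.const_mul C)]
          · rw [integral_const_mul, integral_Ioi_rpow_of_lt (by norm_num) one_pos]
            norm_num
          · refine (ae_restrict_iff' measurableSet_Ioi).2 (ae_of_all _ fun t ht => ?_)
            have ht0 : (0 : ℝ) < t := one_pos.trans ht
            dsimp only [Pi.zero_apply]
            positivity

/-- The mean of the square roots is `o(√log n)`; indeed it is bounded in probability. -/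
lemma tendsto_measure_mean_sqrt {X : ℕ → Ω → ℝ} (hX : ∀ i, AEMeasurable (X i) P)
    {C : ℝ} (hC : 0 ≤ C)
    (htail : ∀ i s, 0 < s → s * P.real {ω | s < X i ω} ≤ C) {δ : ℝ} (hδ : 0 < δ) :
    Tendsto (fun n : ℕ => P {ω | δ * √(Real.log n) ≤ (∑ i : Fin n, √(X i ω)) / n})
      atTop (𝓝 0) := by
  have hsqrt : Tendsto (fun n : ℕ => √(Real.log n)) atTop atTop :=
    Real.tendsto_sqrt_atTop.comp tendsto_log_natCast_atTop
  have hlim : Tendsto (fun n : ℕ => ENNReal.ofReal ((1 + C) / δ / √(Real.log n))) atTop (𝓝 0) := by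
    exact (ENNReal.continuous_ofReal.tendsto' 0 0 ENNReal.ofReal_zero).comp (hsqrt.const_div_atTop ((1 + C) / δ))
  refine tendsto_of_tendsto_of_tendsto_of_le_of_le' tendsto_const_nhds hlim
    (Eventually.of_forall fun _ => zero_le) ?_
  filter_upwards [hsqrt.eventually_gt_atTop 0, eventually_gt_atTop 0] with n hn hn0
  have hnR : (0 : ℝ) < n := by exact_mod_cast hn0
  have hsm : ∀ i, AEMeasurable (fun ω => ENNReal.ofReal √(X i ω)) P := fun i =>
    ENNReal.measurable_ofReal.comp_aemeasurable
      (Real.continuous_sqrt.measurable.comp_aemeasurable (hX i))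
  have hmarkov := meas_ge_le_lintegral_div (μ := P)
    (f := fun ω => ∑ i : Fin n, ENNReal.ofReal √(X i ω))
    (Finset.aemeasurable_fun_sum _ fun i _ => hsm i)
    (ε := ENNReal.ofReal (n * (δ * √(Real.log n)))) (by
      exact (ENNReal.ofReal_pos.2 (by positivity)).ne') ENNReal.ofReal_ne_top
  refine (measure_mono fun ω hω => ?_).trans (hmarkov.trans ?_)
  · simp only [Set.mem_ofPred_eq] at hω ⊢
    rw [← ENNReal.ofReal_sum_of_nonneg fun _ _ => Real.sqrt_nonneg _]
    refine ENNReal.ofReal_le_ofReal ?_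
    rwa [le_div_iff₀ hnR, mul_comm] at hω
  · rw [lintegral_finsetSum' (f := fun (i : Fin n) ω => ENNReal.ofReal √(X i ω)) _
      fun i _ => hsm i]
    calc _ ≤ (∑ _i : Fin n, ENNReal.ofReal (1 + C)) / ENNReal.ofReal (n * (δ * √(Real.log n))) := by
          gcongr with i _
          exact lintegral_sqrt_le (hX i) hC (htail i)
      _ = _ := by
          rw [Finset.sum_const, Finset.card_univ, Fintype.card_fin, nsmul_eq_mul,
            ← ENNReal.ofReal_natCast, ← ENNReal.ofReal_mul hnR.le,
            ← ENNReal.ofReal_div_of_pos (by positivity)]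
          congr 1
          field_simp

end WeakLaw

/-! ### The integrand of the inverse functional -/

/-- The function `z ↦ (z - x)^{-1/2}`, which vanishes for `z ≤ x` by the conventions for square
roots of negative numbers and division by zero. -/
noncomputable def invSqrt (x z : ℝ) : ℝ := 1 / √(z - x)

lemma measurable_invSqrt (x : ℝ) : Measurable (invSqrt x) := by unfold invSqrt; fun_prop

lemma invSqrt_nonneg (x z : ℝ) : 0 ≤ invSqrt x z := by unfold invSqrt; positivity

lemma invSqrt_of_le {x z : ℝ} (h : z ≤ x) : invSqrt x z = 0 := by
  rw [invSqrt, Real.sqrt_eq_zero_of_nonpos (by linarith), div_zero]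

lemma inverseFunctional_eq (μ : Measure ℝ) (x : ℝ) :
    inverseFunctional μ x = ∫ z, invSqrt x z ∂μ :=
  setIntegral_eq_integral_of_forall_compl_eq_zero fun _ hz => invSqrt_of_le (not_lt.1 hz)

lemma inverseFunctional_empiricalMeasure {n : ℕ} (z : Fin n → ℝ) (x : ℝ) :
    inverseFunctional (empiricalMeasure z) x = (∑ i, invSqrt x (z i)) / n := by
  rw [inverseFunctional_eq, empiricalMeasure, integral_smul_measure,
    integral_finsetSum_measure fun i _ => integrable_dirac (by simp)]
  simp [div_eq_inv_mul]

lemma integrable_invSqrt {α : Measure ℝ} {x : ℝ}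
    (h : ∫⁻ s in Set.Ioi x, ENNReal.ofReal ((s - x) ^ (-(1 / 2) : ℝ)) ∂α < ∞) :
    Integrable (invSqrt x) α := by
  have hon : IntegrableOn (invSqrt x) (Set.Ioi x) α := by
    refine ⟨(measurable_invSqrt x).aestronglyMeasurable, ?_⟩
    rw [hasFiniteIntegral_iff_ofReal (ae_of_all _ fun z => invSqrt_nonneg x z)]
    refine lt_of_eq_of_lt (setLIntegral_congr_fun measurableSet_Ioi fun s hs => ?_) h
    have hs' : 0 ≤ s - x := sub_nonneg.2 (le_of_lt hs)
    rw [invSqrt, Real.rpow_neg hs', ← Real.sqrt_eq_rpow, one_div]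
  exact (integrableOn_iff_integrable_of_support_subset fun z hz => by
    by_contra hzx
    exact hz (invSqrt_of_le (not_lt.1 hzx))).1 hon

lemma setOf_lt_invSqrt_sq {x t : ℝ} (ht : 0 < t) :
    {z | t < invSqrt x z ^ 2} = Set.Ioo x (x + 1 / t) := by
  ext z
  simp only [Set.mem_ofPred_eq, Set.mem_Ioo]
  rcases le_or_gt z x with hz | hz
  · rw [invSqrt_of_le hz]
    exact ⟨fun h => by norm_num at h; linarith, fun h => absurd h.1 (not_lt.2 hz)⟩
  · have hzx : 0 < z - x := sub_pos.2 hz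
    rw [invSqrt, div_pow, one_pow, Real.sq_sqrt hzx.le, lt_div_iff₀ hzx, ← lt_div_iff₀' ht]
    exact ⟨fun h => ⟨hz, by linarith⟩, fun h => by linarith [h.2]⟩

/-! ### The law of the observations near `x` -/

lemma measurable_obsDensity_integrand :
    Measurable fun q : ℝ × ℝ =>
      (Set.Ioi q.1).indicator (fun s => ENNReal.ofReal (1 / (2 * √(s ^ 2 - s * q.1)))) q.2 := by
  have h : Measurable fun q : ℝ × ℝ => ENNReal.ofReal (1 / (2 * √(q.2 ^ 2 - q.2 * q.1))) := by
    fun_prop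
  exact h.indicator (measurableSet_lt measurable_fst measurable_snd)

lemma setLIntegral_obsDensity_integrand {x δ s : ℝ} (hδ : 0 < δ) (hs : 0 < s) :
    ∫⁻ z in Set.Ioo x (x + δ),
      (Set.Ioi z).indicator (fun s => ENNReal.ofReal (1 / (2 * √(s ^ 2 - s * z)))) s =
      ENNReal.ofReal ((√(s - x) - √(s - x - δ)) / √s) := by
  rcases le_or_gt s x with hsx | hsx
  · rw [Real.sqrt_eq_zero_of_nonpos (by linarith : s - x ≤ 0),
      Real.sqrt_eq_zero_of_nonpos (by linarith : s - x - δ ≤ 0),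
      setLIntegral_congr_fun (g := fun _ => 0) measurableSet_Ioo]
    · simp
    · intro z hz
      exact Set.indicator_of_notMem (by simp only [Set.mem_Ioi, not_lt]; linarith [hz.1]) _
  · set m := min s (x + δ) with hm
    have hxm : x ≤ m := le_min hsx.le (by linarith)
    have hms : m ≤ s := min_le_left _ _
    have hss : 0 < √s := Real.sqrt_pos.2 hs
    have hroot : ∀ z, √(s ^ 2 - s * z) = √s * √(s - z) := fun z => by
      rw [← Real.sqrt_mul hs.le]; congr 1; ring
    have h1 : ∫⁻ z in Set.Ioo x (x + δ),
        (Set.Ioi z).indicator (fun s => ENNReal.ofReal (1 / (2 * √(s ^ 2 - s * z)))) s =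
        ∫⁻ z in Set.Ioo x m, ENNReal.ofReal (1 / (2 * √(s ^ 2 - s * z))) := by
      have hI : Set.Ioo x m = Set.Iio s ∩ Set.Ioo x (x + δ) := by
        ext z; simp [hm]; tauto
      rw [hI, ← Measure.restrict_restrict measurableSet_Iio, ← lintegral_indicator measurableSet_Iio]
      rfl
    have hcont : ContinuousOn (fun z => -(√(s - z) / √s)) (Set.Icc x m) := by fun_prop
    have hderiv : ∀ z ∈ Set.Ioo x m,
        HasDerivAt (fun z => -(√(s - z) / √s)) (1 / (2 * √(s ^ 2 - s * z))) z := fun z hz => by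
      have hsz : 0 < s - z := by linarith [hz.2]
      have := ((((hasDerivAt_id z).const_sub s).sqrt hsz.ne').div_const √s).neg
      refine this.congr_deriv ?_
      have hsz' : 0 < √(s - z) := Real.sqrt_pos.2 hsz
      rw [hroot, id]
      field_simp
    have hpos : ∀ z ∈ Set.Ioo x m, 0 ≤ 1 / (2 * √(s ^ 2 - s * z)) := fun z _ => by positivity
    have hion := intervalIntegral.integrableOn_deriv_of_nonneg hcont hderiv hpos
    have hint := intervalIntegral.integral_eq_sub_of_hasDerivAt_of_le hxm hcont hderiv
      ((intervalIntegrable_iff_integrableOn_Ioc_of_le hxm).2 hion)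
    rw [h1, setLIntegral_congr Ioo_ae_eq_Ioc, ← ofReal_integral_eq_lintegral_ofReal hion
      (ae_of_all _ fun z => by dsimp only [Pi.zero_apply]; positivity),
      ← intervalIntegral.integral_of_le hxm, hint]
    congr 1
    -- if `m = s`, the junk value of the root of the nonpositive number `s - x - δ` is the right one
    have hend : √(s - m) = √(s - x - δ) := by
      rcases le_total s (x + δ) with h | h
      · rw [hm, min_eq_left h, sub_self, Real.sqrt_zero, Real.sqrt_eq_zero_of_nonpos (by linarith)]
      · rw [hm, min_eq_right h, sub_sub]
    rw [hend]
    ring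

lemma obsLaw_Ioo {F₀ : Measure ℝ} [SFinite F₀] (hF₀ : F₀ (Set.Iic 0) = 0) {x δ : ℝ} (hx : 0 ≤ x)
    (hδ : 0 < δ) :
    obsLaw F₀ (Set.Ioo x (x + δ)) =
      ∫⁻ s, ENNReal.ofReal ((√(s - x) - √(s - x - δ)) / √s) ∂F₀ := by
  have hF₀' : ∀ᵐ s ∂F₀, 0 < s := by
    rw [ae_iff]
    simpa [not_lt, Set.Iic] using hF₀
  rw [obsLaw, withDensity_apply _ measurableSet_Ioo, Measure.restrict_restrict measurableSet_Ioo,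
    Set.inter_eq_left.2 (show Set.Ioo x (x + δ) ⊆ Set.Ici 0 from
      fun z hz => hx.trans (le_of_lt hz.1))]
  simp only [obsDensity]
  simp_rw [← lintegral_indicator measurableSet_Ioi]
  rw [lintegral_lintegral_swap measurable_obsDensity_integrand.aemeasurable]
  refine lintegral_congr_ae ?_
  filter_upwards [hF₀'] with s hs
  exact setLIntegral_obsDensity_integrand hδ hs

lemma mul_sqrt_sub_sqrt_le {u t : ℝ} (ht : 0 < t) (hu : 0 < u) :
    t * (√u - √(u - 1 / t)) ≤ 1 / √u := by
  have hsu : 0 < √u := Real.sqrt_pos.2 hu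
  rw [le_div_iff₀ hsu, mul_assoc, ← le_div_iff₀' ht, sub_mul, Real.mul_self_sqrt hu.le]
  rcases le_total (u - 1 / t) 0 with h | h
  · rw [Real.sqrt_eq_zero_of_nonpos h]
    linarith
  · have h1 : √(u - 1 / t) * √(u - 1 / t) ≤ √(u - 1 / t) * √u :=
      mul_le_mul_of_nonneg_left (Real.sqrt_le_sqrt (by
        have : 0 < 1 / t := by positivity
        linarith)) (Real.sqrt_nonneg _)
    rw [Real.mul_self_sqrt h] at h1
    linarith

lemma tendsto_mul_sqrt_sub_sqrt {u : ℝ} (hu : 0 < u) :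
    Tendsto (fun t : ℝ => t * (√u - √(u - 1 / t))) atTop (𝓝 (1 / (2 * √u))) := by
  have hsu : 0 < √u := Real.sqrt_pos.2 hu
  have h0 : Tendsto (fun t : ℝ => u - 1 / t) atTop (𝓝 u) := by
    simpa using (tendsto_const_nhds (x := u)).sub (tendsto_inv_atTop_zero (𝕜 := ℝ))
  have h1 : Tendsto (fun t : ℝ => 1 / (√u + √(u - 1 / t))) atTop (𝓝 (1 / (2 * √u))) := by
    rw [two_mul]
    exact tendsto_const_nhds.div (tendsto_const_nhds.add ((Real.continuous_sqrt.tendsto u).comp h0))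
      (by positivity)
  refine h1.congr' ?_
  filter_upwards [eventually_gt_atTop 0, h0.eventually (lt_mem_nhds hu)] with t ht ht'
  have h2 : (√u - √(u - 1 / t)) * (√u + √(u - 1 / t)) = 1 / t := by
    have e1 := Real.mul_self_sqrt hu.le
    have e2 := Real.mul_self_sqrt ht'.le
    linear_combination e1 - e2
  rw [eq_comm, eq_div_iff (by positivity), mul_assoc, h2]
  field_simp

/-- The tail function of the squared integrand `(Z - x)⁻¹` under the law of the observations. -/
noncomputable def obsTail (F₀ : Measure ℝ) (x t : ℝ) : ℝ :=
  (obsLaw F₀).real {z | t < invSqrt x z ^ 2}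

lemma ofReal_mul_obsTail {F₀ : Measure ℝ} [SFinite F₀] [IsFiniteMeasure (obsLaw F₀)]
    (hF₀ : F₀ (Set.Iic 0) = 0) {x t : ℝ} (hx : 0 ≤ x) (ht : 0 < t) :
    ENNReal.ofReal (t * obsTail F₀ x t) =
      ∫⁻ s, ENNReal.ofReal (t * (√(s - x) - √(s - x - 1 / t)) / √s) ∂F₀ := by
  rw [ENNReal.ofReal_mul ht.le, obsTail, ofReal_measureReal, setOf_lt_invSqrt_sq ht,
    obsLaw_Ioo hF₀ hx (by positivity), ← lintegral_const_mul _ (by fun_prop)]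
  refine lintegral_congr fun s => ?_
  rw [← ENNReal.ofReal_mul ht.le, mul_div_assoc]

lemma ofReal_mul_sqrt_sub_sqrt_le {x t s : ℝ} (ht : 0 < t) (hs : 0 < s) :
    ENNReal.ofReal (t * (√(s - x) - √(s - x - 1 / t)) / √s) ≤
      2 * (Set.Ioi x).indicator (fun s => ENNReal.ofReal (1 / (2 * √(s ^ 2 - s * x)))) s := by
  have hss : 0 < √s := Real.sqrt_pos.2 hs
  rcases le_or_gt s x with h | h
  · have h1 : 0 ≤ 1 / t := by positivity
    rw [Real.sqrt_eq_zero_of_nonpos (by linarith : s - x ≤ 0),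
      Real.sqrt_eq_zero_of_nonpos (by linarith : s - x - 1 / t ≤ 0)]
    simp
  · have hsx : 0 < √(s - x) := Real.sqrt_pos.2 (by linarith)
    have hroot : √(s ^ 2 - s * x) = √s * √(s - x) := by
      rw [← Real.sqrt_mul hs.le]; congr 1; ring
    rw [Set.indicator_of_mem (Set.mem_Ioi.2 h), ← ENNReal.ofReal_ofNat,
      ← ENNReal.ofReal_mul (by norm_num), hroot]
    refine ENNReal.ofReal_le_ofReal ?_
    rw [div_le_iff₀ hss]
    refine (mul_sqrt_sub_sqrt_le ht (by linarith)).trans (le_of_eq ?_)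
    field_simp

lemma lintegral_indicator_eq_obsDensity (F₀ : Measure ℝ) (x : ℝ) :
    ∫⁻ s, (Set.Ioi x).indicator (fun s => ENNReal.ofReal (1 / (2 * √(s ^ 2 - s * x)))) s ∂F₀ =
      obsDensity F₀ x := by
  rw [lintegral_indicator measurableSet_Ioi, obsDensity]

/-- The pointwise domination by twice the integrand of `g₀(x)`, integrated over `F₀`. -/
lemma mul_obsTail_le {F₀ : Measure ℝ} [SFinite F₀] [IsFiniteMeasure (obsLaw F₀)]
    (hF₀ : F₀ (Set.Iic 0) = 0) {x t : ℝ} (hx : 0 ≤ x) (ht : 0 < t) (hg : obsDensity F₀ x ≠ ∞) :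
    t * obsTail F₀ x t ≤ 2 * (obsDensity F₀ x).toReal := by
  have hF₀' : ∀ᵐ s ∂F₀, 0 < s := by
    rw [ae_iff]
    simpa [not_lt, Set.Iic] using hF₀
  have h : ENNReal.ofReal (t * obsTail F₀ x t) ≤ 2 * obsDensity F₀ x := by
    rw [ofReal_mul_obsTail hF₀ hx ht, ← lintegral_indicator_eq_obsDensity,
      ← lintegral_const_mul' _ _ (by norm_num)]
    refine lintegral_mono_ae ?_
    filter_upwards [hF₀'] with s hs using ofReal_mul_sqrt_sub_sqrt_le ht hs
  have h2 := (ENNReal.ofReal_le_iff_le_toReal (ENNReal.mul_ne_top (by norm_num) hg)).1 h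
  rwa [ENNReal.toReal_mul, ENNReal.toReal_ofNat] at h2

/-- The law of the observations has right derivative `g₀(x)` at `x`, at every point where `g₀` is
finite. No continuity of `g₀` is involved: the difference quotients are averages over `F₀` of
functions dominated by twice the integrand of `g₀(x)`. -/
lemma tendsto_mul_obsTail {F₀ : Measure ℝ} [SFinite F₀] [IsFiniteMeasure (obsLaw F₀)]
    (hF₀ : F₀ (Set.Iic 0) = 0) {x : ℝ} (hx : 0 ≤ x) (hg : obsDensity F₀ x ≠ ∞) :
    Tendsto (fun t => t * obsTail F₀ x t) atTop (𝓝 (obsDensity F₀ x).toReal) := by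
  have hF₀' : ∀ᵐ s ∂F₀, 0 < s := by
    rw [ae_iff]
    simpa [not_lt, Set.Iic] using hF₀
  have hlim : Tendsto (fun t : ℝ =>
      ∫⁻ s, ENNReal.ofReal (t * (√(s - x) - √(s - x - 1 / t)) / √s) ∂F₀) atTop
      (𝓝 (obsDensity F₀ x)) := by
    rw [← lintegral_indicator_eq_obsDensity]
    refine tendsto_lintegral_filter_of_dominated_convergence (fun s => 2 *
      (Set.Ioi x).indicator (fun s => ENNReal.ofReal (1 / (2 * √(s ^ 2 - s * x)))) s)
      (Eventually.of_forall fun t => by fun_prop) ?_ ?_ ?_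
    · filter_upwards [eventually_gt_atTop 0] with t ht
      filter_upwards [hF₀'] with s hs using ofReal_mul_sqrt_sub_sqrt_le ht hs
    · rw [lintegral_const_mul' _ _ (by norm_num), lintegral_indicator_eq_obsDensity]
      exact ENNReal.mul_ne_top (by norm_num) hg
    · filter_upwards [hF₀'] with s hs
      rcases le_or_gt s x with h | h
      · rw [Set.indicator_of_notMem (by simpa using h)]
        refine tendsto_const_nhds.congr' ?_
        filter_upwards [eventually_gt_atTop 0] with t ht
        have h1 : 0 ≤ 1 / t := by positivity
        rw [Real.sqrt_eq_zero_of_nonpos (by linarith : s - x ≤ 0),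
          Real.sqrt_eq_zero_of_nonpos (by linarith : s - x - 1 / t ≤ 0)]
        simp
      · rw [Set.indicator_of_mem (Set.mem_Ioi.2 h)]
        have hroot : √(s ^ 2 - s * x) = √s * √(s - x) := by
          rw [← Real.sqrt_mul hs.le]; congr 1; ring
        have h1 := (tendsto_mul_sqrt_sub_sqrt (sub_pos.2 h)).div_const √s
        have e : 1 / (2 * √(s - x)) / √s = 1 / (2 * √(s ^ 2 - s * x)) := by
          rw [hroot, div_div]; congr 1; ring
        rw [e] at h1
        exact (ENNReal.continuous_ofReal.tendsto _).comp h1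
  have h2 := (ENNReal.tendsto_toReal hg).comp hlim
  refine h2.congr' ?_
  filter_upwards [eventually_gt_atTop 0] with t ht
  simp only [Function.comp_apply]
  rw [← ofReal_mul_obsTail hF₀ hx ht, ENNReal.toReal_ofReal]
  exact mul_nonneg ht.le measureReal_nonneg

lemma antitone_obsTail (F₀ : Measure ℝ) [IsFiniteMeasure (obsLaw F₀)] (x : ℝ) :
    Antitone (obsTail F₀ x) := fun _ _ hst =>
  measureReal_mono fun _ hz => lt_of_le_of_lt hst hz

/-! ### The posterior law for a given sample -/

lemma naivePosteriorLaw_eq {n : ℕ} (Q : Measure (ProbabilityMeasure ℝ)) (z : Fin n → ℝ) (x : ℝ) :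
    naivePosteriorLaw Q z x = Q.map fun G : ProbabilityMeasure ℝ =>
      n / √(n * Real.log n) *
        (∫ s, invSqrt x s ∂(G : Measure ℝ) - (∑ i, invSqrt x (z i)) / n) := by
  rw [naivePosteriorLaw]
  congr 1
  funext G
  rw [inverseFunctional_eq, inverseFunctional_empiricalMeasure, Real.sqrt_mul n.cast_nonneg,
    ← div_div, Real.div_sqrt]

lemma sum_sub_mean_div_sq {n : ℕ} (hn : 0 < n) (a : Fin n → ℝ) {l v : ℝ} (hl : 0 < l)
    (hv : v = (∑ i, a i) / n) :
    ∑ i, ((a i - v) / √(n * l)) ^ 2 = (∑ i, a i ^ 2) / (n * l) - v ^ 2 / l := by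
  have hnR : (0 : ℝ) < n := by exact_mod_cast hn
  have hsum : ∑ i, a i = n * v := by rw [hv]; field_simp
  have h1 : ∑ i, (a i - v) ^ 2 = ∑ i, a i ^ 2 - n * v ^ 2 := by
    simp_rw [sub_sq]
    rw [Finset.sum_add_distrib, Finset.sum_sub_distrib, ← Finset.sum_mul, ← Finset.mul_sum, hsum]
    simp only [Finset.sum_const, Finset.card_univ, Fintype.card_fin, nsmul_eq_mul]
    ring
  simp_rw [div_pow, Real.sq_sqrt (by positivity : 0 ≤ n * l)]
  rw [← Finset.sum_div, h1]
  field_simp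

/-- Normal approximation of the posterior for a given sample, on the event where the sum of squares
of the integrand is close to `v n log n`, no term dominates, and the mean is `o(√log n)`. -/
theorem exists_forall_boundedLipschitzDist_naivePosteriorLaw_le {α : Measure ℝ}
    [IsFiniteMeasure α] (hα : α ≠ 0) {x : ℝ} (hfi : Integrable (invSqrt x) α) (v : ℝ≥0) {ε : ℝ}
    (hε : 0 < ε) :
    ∃ δ : ℝ, 0 < δ ∧ ∀ᶠ n : ℕ in atTop, ∀ (z : Fin n → ℝ) (Q : Measure (ProbabilityMeasure ℝ)),
      IsDirichletProcess (posteriorBase α z) Q →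
      |(∑ i, invSqrt x (z i) ^ 2) / (n * Real.log n) - v| < δ →
      (∀ i, invSqrt x (z i) ^ 2 ≤ δ * (n * Real.log n)) →
      (∑ i, invSqrt x (z i)) / n < δ * √(Real.log n) →
      boundedLipschitzDist (naivePosteriorLaw Q z x) (gaussianReal 0 v) ≤ ENNReal.ofReal ε := by
  obtain ⟨d, hd, hclt⟩ := exists_boundedLipschitzDist_gaussian_le v (half_pos hε)
  -- `d / 2` leaves room for the centering, `d ^ 2` turns the bound on squares into one by `d`, and
  -- `δ ≤ 1 / 2` makes `δ ^ 2 ≤ d / 4`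
  set δ : ℝ := min (min (d / 2) (d ^ 2)) (1 / 2) with hδ
  have hδ0 : 0 < δ := by positivity
  have hδ1 : δ ≤ d / 2 := (min_le_left _ _).trans (min_le_left _ _)
  have hδ2 : δ ≤ d ^ 2 := (min_le_left _ _).trans (min_le_right _ _)
  have hδ3 : δ ≤ 1 / 2 := min_le_right _ _
  set A := ∫ s, |invSqrt x s| ∂α with hA
  set a := α.real Set.univ with ha
  have hA0 : 0 ≤ A := integral_nonneg fun _ => abs_nonneg _
  have ha0 : 0 ≤ a := measureReal_nonneg
  set κ : ℝ := ε / 8 / (v + d) with hκ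
  have hvd : 0 < v + d := add_pos_of_nonneg_of_pos v.2 hd
  have hκ0 : 0 < κ := by positivity
  have hlim1 : Tendsto (fun n : ℕ => κ⁻¹ * (((2 - a) ^ 2 + 1) / ((n : ℝ) - 2))) atTop (𝓝 0) := by
    have h1 : Tendsto (fun n : ℕ => (n : ℝ) - 2) atTop atTop :=
      tendsto_atTop_add_const_right _ (-2) tendsto_natCast_atTop_atTop
    simpa using (h1.const_div_atTop ((2 - a) ^ 2 + 1)).const_mul κ⁻¹
  have hlim2 : Tendsto (fun n : ℕ => 2 * (A / √(n * Real.log n) + a / √n)) atTop (𝓝 0) := by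
    have h1 := (Real.tendsto_sqrt_atTop.comp tendsto_natCast_mul_log_atTop).const_div_atTop A
    have h2 := (Real.tendsto_sqrt_atTop.comp
      (tendsto_natCast_atTop_atTop (R := ℝ))).const_div_atTop a
    simpa using (h1.add h2).const_mul 2
  refine ⟨δ, hδ0, ?_⟩
  filter_upwards [hlim1.eventually_lt_const (show 0 < ε / 8 by positivity),
    hlim2.eventually_lt_const (show 0 < ε / 8 by positivity), eventually_ge_atTop 3,
    tendsto_log_natCast_atTop.eventually_gt_atTop 0] with n h1 h2 hn hl z Q hQ hsq hmax hmean
  have hnR : (3 : ℝ) ≤ n := by exact_mod_cast hn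
  set l := Real.log n with hl_def
  set V := (∑ i, invSqrt x (z i)) / n with hV
  have hV0 : 0 ≤ V := div_nonneg (Finset.sum_nonneg fun i _ => invSqrt_nonneg _ _) (by positivity)
  have hr : 0 < √(n * l) := Real.sqrt_pos.2 (by positivity)
  have hsl : 0 < √l := Real.sqrt_pos.2 hl
  have hsn : 1 ≤ √n := Real.one_le_sqrt.2 (by linarith)
  have hrs : √(n * l) = √n * √l := Real.sqrt_mul n.cast_nonneg l
  -- `∑ uᵢ²` differs from the normalized sum of squares by this term
  have hV2 : V ^ 2 / l ≤ d / 4 := by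
    rw [div_le_iff₀ hl]
    calc V ^ 2 ≤ (δ * √l) ^ 2 := by gcongr
      _ = δ * δ * l := by rw [mul_pow, Real.sq_sqrt hl.le, sq]
      _ ≤ d / 4 * l := by
        gcongr
        nlinarith
  have hVr : V / √(n * l) ≤ δ / √n := by
    rw [hrs, div_le_div_iff₀ (by positivity) (by positivity)]
    nlinarith
  have hVr' : V / √(n * l) ≤ δ := hVr.trans (div_le_self hδ0.le hsn)
  have hsum := sum_sub_mean_div_sq (by omega : 0 < n) (fun i => invSqrt x (z i)) hl hV
  have hsum_close : |∑ i, ((invSqrt x (z i) - V) / √(n * l)) ^ 2 - v| ≤ d := by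
    rw [hsum]
    have h3 : 0 ≤ V ^ 2 / l := by positivity
    have h4 := abs_lt.1 hsq
    rw [abs_le]
    constructor <;> linarith [h4.1, h4.2]
  have hmax' : ∀ i, |(invSqrt x (z i) - V) / √(n * l)| ≤ d := fun i => by
    have h3 : invSqrt x (z i) / √(n * l) ≤ d := by
      rw [div_le_iff₀ hr]
      refine le_of_sq_le_sq ?_ (by positivity)
      rw [mul_pow, Real.sq_sqrt (by positivity)]
      exact (hmax i).trans (by gcongr)
    have h4 : 0 ≤ invSqrt x (z i) / √(n * l) := div_nonneg (invSqrt_nonneg _ _) hr.le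
    have h5 : 0 ≤ V / √(n * l) := by positivity
    rw [sub_div, abs_le]
    constructor <;> linarith
  obtain ⟨μ, hμ, hchar, hμ2, hdist⟩ := exists_boundedLipschitzDist_posterior_le hα
    (measurable_invSqrt x) hfi hn z hQ hV hr hκ0 (show 0 < ε / 8 by positivity)
  have hgauss := hclt μ n _ hsum_close hmax' hchar hμ2
  rw [← naivePosteriorLaw_eq] at hdist
  refine (boundedLipschitzDist_triangle _ _ _).trans ((add_le_add hdist hgauss).trans ?_)
  have hS0 : 0 ≤ ∑ i, ((invSqrt x (z i) - V) / √(n * l)) ^ 2 :=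
    Finset.sum_nonneg fun _ _ => sq_nonneg _
  have e1 : κ * ∑ i, ((invSqrt x (z i) - V) / √(n * l)) ^ 2 ≤ ε / 8 := by
    calc _ ≤ κ * (v + d) := by
          gcongr
          linarith [(abs_le.1 hsum_close).2]
      _ = ε / 8 := by rw [hκ]; field_simp
  have e2 : 2 * ((A + |V| * a) / √(n * l)) ≤ ε / 8 := by
    have h3 : V * a / √(n * l) ≤ a / √n := by
      calc V * a / √(n * l) = a * (V / √(n * l)) := by ring
        _ ≤ a * (1 / √n) :=
          mul_le_mul_of_nonneg_left (hVr.trans (div_le_div_of_nonneg_right (by linarith)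
            (Real.sqrt_nonneg _))) ha0
        _ = a / √n := by ring
    rw [abs_of_nonneg hV0, add_div]
    linarith
  have e3 : 0 ≤ κ⁻¹ * (((2 - a) ^ 2 + 1) / ((n : ℝ) - 2)) :=
    mul_nonneg (inv_nonneg.2 hκ0.le) (div_nonneg (by positivity) (by linarith))
  rw [← ENNReal.ofReal_add (by positivity) (by positivity)]
  exact ENNReal.ofReal_le_ofReal (by linarith)

end Wicksell

theorem theorem1
    {Ω : Type*} [MeasurableSpace Ω] (P : Measure Ω) [IsProbabilityMeasure P]
    -- the law of the unobservable squared radius, with bounded density of the observables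
    (F₀ : Measure ℝ) [IsProbabilityMeasure F₀] (hF₀ : F₀ (Set.Iic 0) = 0)
    (hg₀ : (⨆ z : Set.Ici (0 : ℝ), Wicksell.obsDensity F₀ z) < ∞)
    -- the observations
    (Z : ℕ → Ω → ℝ) (hZ_law : ∀ i, HasLaw (Z i) (Wicksell.obsLaw F₀) P)
    (hZ_indep : iIndepFun Z P)
    (x : ℝ) (hx : 0 ≤ x)
    -- the base measure of the prior, a nonzero finite measure on the half line
    (α : Measure ℝ) [IsFiniteMeasure α] (hα : α ≠ 0) (hα_nonneg : α (Set.Iio 0) = 0)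
    (hα_int : ∫⁻ s in Set.Ioi x, ENNReal.ofReal ((s - x) ^ (-(1 / 2) : ℝ)) ∂α < ∞)
    -- the posterior given the sample
    (Q : (n : ℕ) → (Fin n → ℝ) → Measure (ProbabilityMeasure ℝ))
    (hQ : ∀ n z, Wicksell.IsDirichletProcess (Wicksell.posteriorBase α z) (Q n z)) :
    (∀ (n : ℕ) (z : Fin n → ℝ), ∀ᵐ G : ProbabilityMeasure ℝ ∂(Q n z),
      IntegrableOn (fun s : ℝ => 1 / √(s - x)) (Set.Ioi x) (G : Measure ℝ)) ∧
    ∀ ε : ℝ≥0∞, 0 < ε →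
      Tendsto (fun n : ℕ => P {ω | ε ≤ Wicksell.boundedLipschitzDist
          (Wicksell.naivePosteriorLaw (Q n fun i : Fin n => Z i ω) (fun i : Fin n => Z i ω) x)
          (gaussianReal 0 (Wicksell.obsDensity F₀ x).toNNReal)})
        atTop (𝓝 0) := by
  open Wicksell in
  have hfi : Integrable (invSqrt x) α := integrable_invSqrt hα_int
  refine ⟨fun n z => ?_, fun ε hε => ?_⟩
  · filter_upwards [(hQ n z).ae_integrable (posteriorBase_ne_zero hα z) (measurable_invSqrt x)
      (integrable_posteriorBase hfi z)] with G hG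
    exact hG.integrableOn
  have hgx : obsDensity F₀ x ≠ ∞ :=
    ((le_iSup (fun z : Set.Ici (0 : ℝ) => obsDensity F₀ z) ⟨x, hx⟩).trans_lt hg₀).ne
  have hprob : IsProbabilityMeasure (obsLaw F₀) := by
    rw [← (hZ_law 0).map_eq]
    exact Measure.isProbabilityMeasure_map (hZ_law 0).aemeasurable
  obtain ⟨e, he0, heε⟩ : ∃ e : ℝ, 0 < e ∧ ENNReal.ofReal e < ε := by
    obtain ⟨e, he0, heε⟩ := ENNReal.lt_iff_exists_nnreal_btwn.1 hε
    exact ⟨e, by exact_mod_cast he0, by rwa [ENNReal.ofReal_coe_nnreal]⟩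
  obtain ⟨δ, hδ, hev⟩ := exists_forall_boundedLipschitzDist_naivePosteriorLaw_le hα hfi
    (obsDensity F₀ x).toNNReal he0
  set X : ℕ → Ω → ℝ := fun i ω => invSqrt x (Z i ω) ^ 2 with hX
  have hsqm : Measurable fun z => invSqrt x z ^ 2 := (measurable_invSqrt x).pow_const 2
  have hXm : ∀ i, AEMeasurable (X i) P := fun i => hsqm.comp_aemeasurable (hZ_law i).aemeasurable
  have hXtail : ∀ i s, 0 < s → P.real {ω | s < X i ω} = obsTail F₀ x s := fun i s _ =>
    (hZ_law i).measureReal_eq (p := fun z => s < invSqrt x z ^ 2)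
      (measurableSet_lt measurable_const hsqm)
  have hC : 0 ≤ 2 * (obsDensity F₀ x).toReal := by positivity
  have hXtail' : ∀ i s, 0 < s →
      s * P.real {ω | s < X i ω} ≤ 2 * (obsDensity F₀ x).toReal := fun i s hs => by
    rw [hXtail i s hs]
    exact mul_obsTail_le hF₀ hx hs hgx
  have hXindep : iIndepFun X P := hZ_indep.comp (fun _ z => invSqrt x z ^ 2) fun _ => hsqm
  have l1 := tendsto_measure_sum_div_log hXm (fun i ω => sq_nonneg _) hXindep
    (antitone_obsTail F₀ x) (fun _ => measureReal_nonneg) (fun _ => measureReal_le_one) hXtail hC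
    (fun s hs => mul_obsTail_le hF₀ hx hs hgx) (tendsto_mul_obsTail hF₀ hx hgx) hδ
  have l2 := tendsto_measure_exists_lt hXtail' hδ
  have l3 := tendsto_measure_mean_sqrt hXm hC hXtail' hδ
  have hlim := (l1.add l2).add l3
  simp only [add_zero] at hlim
  refine tendsto_of_tendsto_of_tendsto_of_le_of_le' tendsto_const_nhds hlim
    (Eventually.of_forall fun _ => zero_le) ?_
  filter_upwards [hev] with n hn
  refine (measure_mono fun ω hω => ?_).trans ((measure_union_le _ _).trans
    (add_le_add_left (measure_union_le _ _) _))
  by_contra hcon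
  simp only [Set.mem_union, Set.mem_ofPred_eq, not_or, not_le, not_exists, not_lt] at hcon
  obtain ⟨⟨c1, c2⟩, c3⟩ := hcon
  have hroot : ∀ i, √(X i ω) = invSqrt x (Z i ω) := fun i => Real.sqrt_sq (invSqrt_nonneg _ _)
  simp only [hroot] at c3
  have := hn (fun i : Fin n => Z i ω) (Q n fun i : Fin n => Z i ω) (hQ n _) c1 c2 c3
  exact absurd (hω.trans this) (not_le.2 heε)
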